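/- Let $k$ be a field. For a finite simple graph $G=(V,E)$, let $k[V]$ and $k[E]$ be the polynomial rings over $k$ whose variables are the vertices and the edges of $G$, respectively, and let the toric ring $k[G]$ be the image of the $k$-algebra homomorphism $\phi_G\colon k[E]\to k[V]$ sending each edge $e=\{x,y\}$ to $xy$. View $k[G]$ as a graded $k[E]$-module through $\phi_G$, where every edge has degree $1$ (so $k[G]_j=\phi_G(k[E]_j)$). Let $\beta_{i,j}(k[G])$ be its graded Betti numbers, i.e. the number of generators of degree $j$ of the $i$-th free module in a minimal graded free resolution of $k[G]$ over $k[E]$. Let $\operatorname{reg} k[G]=\sup\{\,j-i : \beta_{i,j}(k[G])\neq 0\,\}$ be the Castelnuovo–Mumford regularity, and let $\operatorname{pd} k[G]$ be the projective dimension of $k[G]$ as a $k[E]$-module. Let $H_1,\dots,H_s$ be finite simple graphs and let $H$ be their disjoint union. Then $$\operatorname{reg} k[H]=\sum_{i=1}^s \operatorname{reg} k[H_i]\qquad\text{and}\qquad \operatorname{pd} k[H]=\sum_{i=1}^s \operatorname{pd} k[H_i].$$ -/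

import Mathlib

open MvPolynomial

noncomputable section

namespace SimpleGraph

/-- The disjoint union of a family of simple graphs: the vertex set is the disjoint union of the
vertex sets, and the edges are exactly the edges of the members of the family. -/
def disjointUnion {ι : Type*} {V : ι → Type*} (H : ∀ i, SimpleGraph (V i)) :
    SimpleGraph (Σ i, V i) where
  Adj x y := ∃ (i : ι) (a b : V i), (H i).Adj a b ∧ x = ⟨i, a⟩ ∧ y = ⟨i, b⟩
  symm := by
    constructor
    rintro _ _ ⟨i, a, b, hab, rfl, rfl⟩
    exact ⟨i, b, a, hab.symm, rfl, rfl⟩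
  loopless := by
    constructor
    rintro _ ⟨i, a, b, hab, rfl, h⟩
    obtain rfl : a = b := eq_of_heq (Sigma.mk.inj h).2
    exact hab.ne rfl

end SimpleGraph

/-- A minimal graded free resolution
`⋯ → S^(rank 2) → S^(rank 1) → S^(rank 0) → M → 0`
of a graded module `M = ⨁ⱼ ℳ j` over the standard graded polynomial ring `S = k[σ]`. The `b`-th
basis vector of the `i`-th free module is homogeneous of degree `deg i b`; all maps are homogeneous
of degree zero, and the image of each differential lies in `𝔪 S^(rank i)`, where `𝔪 = (σ)`. -/
structure MinimalGradedFreeResolution (k : Type*) [Field k] (σ : Type*) {M : Type*}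
    [AddCommGroup M] [Module k M] [Module (MvPolynomial σ k) M] (ℳ : ℕ → Submodule k M) where
  rank : ℕ → ℕ
  deg : ∀ i, Fin (rank i) → ℕ
  d : ∀ i, (Fin (rank (i + 1)) → MvPolynomial σ k) →ₗ[MvPolynomial σ k]
    (Fin (rank i) → MvPolynomial σ k)
  aug : (Fin (rank 0) → MvPolynomial σ k) →ₗ[MvPolynomial σ k] M
  aug_homogeneous : ∀ b, aug (Pi.single b 1) ∈ ℳ (deg 0 b)
  d_homogeneous : ∀ i b c m, coeff m (d i (Pi.single b 1) c) ≠ 0 →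
    m.degree + deg i c = deg (i + 1) b
  aug_surjective : Function.Surjective aug
  exact_aug : Function.Exact (d 0) aug
  exact_d : ∀ i, Function.Exact (d (i + 1)) (d i)
  minimal : ∀ i b c, constantCoeff (d i (Pi.single b 1) c) = 0

/-- The graded Betti number `β_{i,j}(M)`: the number of generators of degree `j` of the `i`-th free
module in a minimal graded free resolution of `M`. Minimal graded free resolutions are unique up to
isomorphism, so the supremum is their common value. -/
def gradedBetti (k : Type*) [Field k] (σ : Type*) {M : Type*}
    [AddCommGroup M] [Module k M] [Module (MvPolynomial σ k) M] (ℳ : ℕ → Submodule k M)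
    (i j : ℕ) : ℕ∞ :=
  ⨆ F : MinimalGradedFreeResolution k σ ℳ, (Nat.card {b : Fin (F.rank i) // F.deg i b = j} : ℕ∞)

/-- The Castelnuovo-Mumford regularity `sup {j - i | β_{i,j}(M) ≠ 0}`, as an extended integer. -/
def regularity (k : Type*) [Field k] (σ : Type*) {M : Type*}
    [AddCommGroup M] [Module k M] [Module (MvPolynomial σ k) M] (ℳ : ℕ → Submodule k M) :
    WithBot (WithTop ℤ) :=
  ⨆ (i : ℕ) (j : ℕ) (_ : gradedBetti k σ ℳ i j ≠ 0),
    ((((j : ℤ) - (i : ℤ) : ℤ) : WithTop ℤ) : WithBot (WithTop ℤ))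

section Toric

variable {V : Type*} (k : Type*) [Field k] (G : SimpleGraph V)

/-- The `k`-algebra homomorphism `φ_G : k[E] → k[V]`, `{x, y} ↦ x y`. -/
def toricMap : MvPolynomial G.edgeSet k →ₐ[k] MvPolynomial V k :=
  aeval fun e : G.edgeSet =>
    Sym2.lift ⟨fun x y => (X x * X y : MvPolynomial V k), fun x y => mul_comm (X x) (X y)⟩
      (e : Sym2 V)

/-- The toric ring `k[G]`, the image of `φ_G`. -/
def ToricRing : Type _ := (toricMap k G).range

instance : CommRing (ToricRing k G) := inferInstanceAs (CommRing (toricMap k G).range)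

instance : Algebra k (ToricRing k G) := inferInstanceAs (Algebra k (toricMap k G).range)

/-- The surjection `k[E] → k[G]`. -/
def toricProj : MvPolynomial G.edgeSet k →ₐ[k] ToricRing k G := (toricMap k G).rangeRestrict

/-- `k[G]` is a `k[E]`-algebra through `φ_G`. -/
instance : Algebra (MvPolynomial G.edgeSet k) (ToricRing k G) :=
  (toricProj k G).toRingHom.toAlgebra

/-- The standard grading of `k[G]`, in which every edge has degree `1`: the component of degree `j`
is the image of the homogeneous polynomials of degree `j` in `k[E]`. -/
def toricGrading (j : ℕ) : Submodule k (ToricRing k G) :=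
  (homogeneousSubmodule G.edgeSet k j).map (toricProj k G).toLinearMap

/-- The regularity of `k[G]` as a graded `k[E]`-module. -/
def toricReg : WithBot (WithTop ℤ) := regularity k G.edgeSet (toricGrading k G)

/-- The projective dimension of `k[G]` as a `k[E]`-module. -/
def toricPd : WithBot ℕ∞ :=
  CategoryTheory.projectiveDimension
    (ModuleCat.of (MvPolynomial G.edgeSet k) (ToricRing k G))

end Toric

end

/-! If a graph is the disjoint union of `G₁` and `G₂`, its edge ring is `k[E₁] ⊗ k[E₂]`, and its
toric ring is `k[G₁] ⊗ k[G₂]`, tensor products over `k`. Surjectivity of the multiplication map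
holds on generators. Injectivity holds because both toric rings lie in polynomial rings in disjoint
sets of vertices and `k` is a field (`IsDisjointUnion.isExternalTensor`).

The tensor product over `k` of two minimal graded free resolutions is again one
(`TotalResolution.tensor`). Its basis is the product of the two bases, with homological and internal
degrees added. Exactness comes from `k`-linear contracting homotopies of the factors, which combine
into one for the tensor product (`tensor_homotopy`).

Both invariants are suprema over the basis of any minimal resolution: of internal minus homological
degree for the regularity, of the homological degree for the projective dimension. The first needs
uniqueness of minimal resolutions (`exists_comparison`). The second needs dimension shifting and the
fact that a minimal cover of a projective module is injective (`hasProjectiveDimensionLE_iff`). A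
supremum of sums over a product of nonempty index sets is the sum of the suprema, which gives
additivity for two graphs; induction on the number of graphs finishes the proof. Finite length of
the resolutions is never needed, since the suprema may be infinite. -/

noncomputable section

/-! ### Homogeneous vectors in graded free modules. -/

section GradedVectors

variable {k : Type*} [Field k] {σ : Type*} {ι κ : Type*}

/-- A vector over `k[σ]` is homogeneous of degree `j` if its `c`-th entry is homogeneous of degree
`j - deg c`. -/
def IsHomogeneousVec (deg : ι → ℕ) (j : ℕ) (x : ι → MvPolynomial σ k) : Prop :=
  ∀ c m, coeff m (x c) ≠ 0 → m.degree + deg c = j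

/-- The homogeneous component of degree `j` of a vector. -/
def vecComponent (deg : ι → ℕ) (j : ℕ) :
    (ι → MvPolynomial σ k) →ₗ[k] (ι → MvPolynomial σ k) :=
  LinearMap.pi fun c =>
    -- Without the guard, truncated subtraction would wrongly keep the constant term of entries with
    -- `deg c > j`.
    (if deg c ≤ j then homogeneousComponent (j - deg c) else 0) ∘ₗ LinearMap.proj c

lemma coeff_vecComponent (deg : ι → ℕ) (j : ℕ) (x : ι → MvPolynomial σ k) (c : ι) (m : σ →₀ ℕ) :
    coeff m (vecComponent deg j x c) = if m.degree + deg c = j then coeff m (x c) else 0 := by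
  unfold vecComponent
  by_cases h : deg c ≤ j
  · have : m.degree = j - deg c ↔ m.degree + deg c = j := by omega
    simp [h, coeff_homogeneousComponent, this]
  · have : ¬ m.degree + deg c = j := by omega
    simp [h, this]

lemma isHomogeneousVec_vecComponent (deg : ι → ℕ) (j : ℕ) (x : ι → MvPolynomial σ k) :
    IsHomogeneousVec deg j (vecComponent deg j x) := by
  intro c m h
  rw [coeff_vecComponent] at h
  by_contra h'
  simp [h'] at h

lemma IsHomogeneousVec.vecComponent_eq {deg : ι → ℕ} {i : ℕ} {x : ι → MvPolynomial σ k}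
    (hx : IsHomogeneousVec deg i x) (j : ℕ) :
    vecComponent deg j x = if i = j then x else 0 := by
  funext c
  ext m
  rw [coeff_vecComponent]
  by_cases hm : coeff m (x c) = 0
  · by_cases hij : i = j <;> simp [hm, hij]
  · rw [hx c m hm]
    by_cases hij : i = j <;> simp [hij]

lemma sum_vecComponent [Finite ι] (deg : ι → ℕ) (x : ι → MvPolynomial σ k) :
    ∃ n₀, ∀ n, n₀ ≤ n → ∑ i ∈ Finset.range n, vecComponent deg i x = x := by
  cases nonempty_fintype ι
  refine ⟨∑ c, ((x c).totalDegree + deg c) + 1, fun n hn => ?_⟩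
  funext c
  ext m
  rw [Finset.sum_apply, coeff_sum]
  simp_rw [coeff_vecComponent]
  by_cases hm : coeff m (x c) = 0
  · simp [hm]
  · have h1 : m.degree ≤ (x c).totalDegree := le_totalDegree (mem_support_iff.2 hm)
    have h2 : (x c).totalDegree + deg c ≤ ∑ c, ((x c).totalDegree + deg c) :=
      Finset.single_le_sum (f := fun c => (x c).totalDegree + deg c)
        (fun _ _ => Nat.zero_le _) (Finset.mem_univ c)
    rw [Finset.sum_ite_eq, if_pos (Finset.mem_range.2 (by omega))]

lemma degree_eq_weight_one_apply (m : σ →₀ ℕ) :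
    m.degree = Finsupp.weight (1 : σ → ℕ) m := by
  rw [Finsupp.degree_eq_weight_one (R := ℕ)]
  rfl

lemma IsHomogeneousVec.isHomogeneous {deg : ι → ℕ} {j : ℕ} {x : ι → MvPolynomial σ k}
    (hx : IsHomogeneousVec deg j x) (c : ι) : (x c).IsHomogeneous (j - deg c) := by
  intro m hm
  have h := hx c m hm
  rw [← degree_eq_weight_one_apply]
  omega

lemma IsHomogeneousVec.eq_zero_of_lt {deg : ι → ℕ} {j : ℕ} {x : ι → MvPolynomial σ k}
    (hx : IsHomogeneousVec deg j x) {c : ι} (hc : j < deg c) : x c = 0 := by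
  ext m
  by_contra h
  have := hx c m (by simpa using h)
  omega

lemma isHomogeneousVec_zero (deg : ι → ℕ) (j : ℕ) :
    IsHomogeneousVec deg j (0 : ι → MvPolynomial σ k) := by
  intro c m h; simp at h

lemma IsHomogeneousVec.add {deg : ι → ℕ} {j : ℕ} {x y : ι → MvPolynomial σ k}
    (hx : IsHomogeneousVec deg j x) (hy : IsHomogeneousVec deg j y) :
    IsHomogeneousVec deg j (x + y) := by
  intro c m h
  by_cases h1 : coeff m (x c) = 0
  · exact hy c m (by simpa [h1] using h)
  · exact hx c m h1

lemma isHomogeneousVec_single [DecidableEq ι] (deg : ι → ℕ) (b : ι) :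
    IsHomogeneousVec deg (deg b) (Pi.single b (1 : MvPolynomial σ k)) := by
  classical
  intro c m h
  by_cases hc : c = b
  · subst hc
    rw [Pi.single_eq_same, coeff_one] at h
    have : m = 0 := by by_contra h'; exact h (if_neg fun h'' => h' h''.symm)
    simp [this]
  · simp [hc] at h

lemma coeff_mul_ne_zero {p q : MvPolynomial σ k} {m : σ →₀ ℕ} (h : coeff m (p * q) ≠ 0) :
    ∃ a b, coeff a p ≠ 0 ∧ coeff b q ≠ 0 ∧ a + b = m := by
  classical
  rw [coeff_mul] at h
  obtain ⟨⟨a, b⟩, hab, hne⟩ := Finset.exists_ne_zero_of_sum_ne_zero h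
  refine ⟨a, b, left_ne_zero_of_mul hne, right_ne_zero_of_mul hne, ?_⟩
  simpa using hab

/-- The vectors that are homogeneous of degree `j`. -/
def vecGrading (k : Type*) [Field k] (σ : Type*) {ι : Type*} (deg : ι → ℕ) (j : ℕ) :
    Submodule k (ι → MvPolynomial σ k) where
  carrier := {x | IsHomogeneousVec deg j x}
  add_mem' hx hy := hx.add hy
  zero_mem' := isHomogeneousVec_zero deg j
  smul_mem' a x hx := by
    intro c m h
    refine hx c m fun h' => h ?_
    simp [h']

end GradedVectors

lemma linearMap_apply_eq_sum {R N ι : Type*} [CommRing R] [AddCommGroup N] [Module R N]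
    [Fintype ι] [DecidableEq ι] (f : (ι → R) →ₗ[R] N) (x : ι → R) :
    f x = ∑ c, x c • f (Pi.single c 1) := by
  conv_lhs => rw [pi_eq_sum_univ' x]
  simp only [map_sum, map_smul]

/-! ### Graded modules and homogeneous maps out of free modules. -/

section GradedModules

variable {k : Type*} [Field k] {σ : Type*} {N : Type*} [AddCommGroup N] [Module k N]
  [Module (MvPolynomial σ k) N]

/-- The subspaces `𝒩 j` are the homogeneous components of a graded `k[σ]`-module (which they need
not span). -/
structure IsGradedFamily (𝒩 : ℕ → Submodule k N) : Prop where
  smul_mem : ∀ {i j : ℕ} {p : MvPolynomial σ k} {x : N}, p.IsHomogeneous i → x ∈ 𝒩 j →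
    p • x ∈ 𝒩 (i + j)
  exists_proj : ∀ j, ∃ P : N →ₗ[k] N, ∀ i, ∀ x ∈ 𝒩 i, P x = if i = j then x else 0

/-- Syzygies live in free modules, so this lets the results on graded modules apply at every stage
of a resolution, not only at the augmentation. -/
lemma isGradedFamily_vecGrading {ι : Type*} (deg : ι → ℕ) :
    IsGradedFamily (σ := σ) (vecGrading k σ deg) where
  smul_mem := by
    intro i j p x hp hx c m h
    obtain ⟨a, b, ha, hb, rfl⟩ := coeff_mul_ne_zero h
    have h1 := hx c b hb
    have h2 : a.degree = i := by
      have := hp ha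
      rwa [← degree_eq_weight_one_apply] at this
    rw [map_add]
    omega
  exists_proj j := ⟨vecComponent deg j, fun i x hx => hx.vecComponent_eq j⟩

variable {ι : Type*} [Finite ι] [DecidableEq ι]
  {𝒩 : ℕ → Submodule k N} {deg : ι → ℕ} {f : (ι → MvPolynomial σ k) →ₗ[MvPolynomial σ k] N}

lemma IsGradedFamily.apply_mem (h𝒩 : IsGradedFamily (σ := σ) 𝒩)
    (hf : ∀ b, f (Pi.single b 1) ∈ 𝒩 (deg b)) {j : ℕ} {x : ι → MvPolynomial σ k}
    (hx : IsHomogeneousVec deg j x) : f x ∈ 𝒩 j := by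
  cases nonempty_fintype ι
  rw [linearMap_apply_eq_sum f]
  refine Submodule.sum_mem _ fun c _ => ?_
  by_cases hc : deg c ≤ j
  · have := h𝒩.smul_mem (hx.isHomogeneous c) (hf c)
    rwa [Nat.sub_add_cancel hc] at this
  · rw [hx.eq_zero_of_lt (by omega), zero_smul]
    exact zero_mem _

/-- Each homogeneous piece of `x` is sent into a single component, and `P` keeps only the one of
degree `j`. Homogeneity of kernels and homogeneous lifting both follow from this. -/
lemma IsGradedFamily.proj_apply (h𝒩 : IsGradedFamily (σ := σ) 𝒩)
    (hf : ∀ b, f (Pi.single b 1) ∈ 𝒩 (deg b)) {j : ℕ} {P : N →ₗ[k] N}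
    (hP : ∀ i, ∀ x ∈ 𝒩 i, P x = if i = j then x else 0) (x : ι → MvPolynomial σ k) :
    P (f x) = f (vecComponent deg j x) := by
  obtain ⟨n, hn⟩ := sum_vecComponent deg x
  -- The range must be long enough both to recover `x` and to contain the index `j`.
  conv_lhs => rw [← hn (max n (j + 1)) (le_max_left _ _)]
  rw [map_sum, map_sum, Finset.sum_congr rfl fun i _ =>
    hP i _ (h𝒩.apply_mem hf (isHomogeneousVec_vecComponent deg i x))]
  rw [Finset.sum_ite_eq', if_pos (Finset.mem_range.2 (by omega))]

/-- The kernel of a homogeneous map is homogeneous. -/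
lemma IsGradedFamily.vecComponent_mem_ker (h𝒩 : IsGradedFamily (σ := σ) 𝒩)
    (hf : ∀ b, f (Pi.single b 1) ∈ 𝒩 (deg b)) {x : ι → MvPolynomial σ k} (hx : f x = 0) (j : ℕ) :
    f (vecComponent deg j x) = 0 := by
  obtain ⟨P, hP⟩ := h𝒩.exists_proj j
  rw [← h𝒩.proj_apply hf hP, hx, map_zero]

/-- Homogeneous elements of the image of a homogeneous map have homogeneous preimages. -/
lemma IsGradedFamily.exists_isHomogeneousVec (h𝒩 : IsGradedFamily (σ := σ) 𝒩)
    (hf : ∀ b, f (Pi.single b 1) ∈ 𝒩 (deg b)) {j : ℕ} {y : N} (hy : y ∈ 𝒩 j)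
    (hyf : y ∈ LinearMap.range f) : ∃ x, IsHomogeneousVec deg j x ∧ f x = y := by
  obtain ⟨P, hP⟩ := h𝒩.exists_proj j
  obtain ⟨x, rfl⟩ := hyf
  refine ⟨vecComponent deg j x, isHomogeneousVec_vecComponent deg j x, ?_⟩
  rw [← h𝒩.proj_apply hf hP, hP j _ hy, if_pos rfl]

end GradedModules

end

noncomputable section

/-! ### Minimal covers and graded Nakayama arguments. -/

section MinimalCovers

variable {k : Type*} [Field k] {σ : Type*} {N : Type*} [AddCommGroup N] [Module k N]
  [Module (MvPolynomial σ k) N]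

/-- A homogeneous map from a graded free module of finite rank whose kernel has no entries with a
nonzero constant term. -/
structure IsMinimalCover (𝒩 : ℕ → Submodule k N) {ι : Type*} [DecidableEq ι] (deg : ι → ℕ)
    (f : (ι → MvPolynomial σ k) →ₗ[MvPolynomial σ k] N) : Prop where
  apply_single_mem : ∀ b, f (Pi.single b 1) ∈ 𝒩 (deg b)
  constantCoeff_eq_zero : ∀ x, f x = 0 → ∀ c, constantCoeff (x c) = 0

variable {ι κ : Type*} [Finite ι] [Finite κ] [DecidableEq ι] [DecidableEq κ]
  {𝒩 : ℕ → Submodule k N} {deg : ι → ℕ} {deg' : κ → ℕ}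
  {f : (ι → MvPolynomial σ k) →ₗ[MvPolynomial σ k] N}
  {g : (κ → MvPolynomial σ k) →ₗ[MvPolynomial σ k] N}

/-- Homogeneous maps of degree zero lift along homogeneous surjections. -/
lemma IsGradedFamily.exists_lift (h𝒩 : IsGradedFamily (σ := σ) 𝒩)
    (hf : ∀ b, f (Pi.single b 1) ∈ 𝒩 (deg b)) (hg : ∀ b, g (Pi.single b 1) ∈ 𝒩 (deg' b))
    (h : LinearMap.range f ≤ LinearMap.range g) :
    ∃ φ : (ι → MvPolynomial σ k) →ₗ[MvPolynomial σ k] (κ → MvPolynomial σ k),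
      (∀ b, IsHomogeneousVec deg' (deg b) (φ (Pi.single b 1))) ∧ g ∘ₗ φ = f := by
  cases nonempty_fintype ι
  choose y hy hgy using fun b => h𝒩.exists_isHomogeneousVec hg (hf b) (h ⟨Pi.single b 1, rfl⟩)
  refine ⟨(Pi.basisFun (MvPolynomial σ k) ι).constr ℕ y, fun b => ?_, ?_⟩
  · rw [← Pi.basisFun_apply, Module.Basis.constr_basis]
    exact hy b
  · refine (Pi.basisFun (MvPolynomial σ k) ι).ext fun b => ?_
    rw [LinearMap.comp_apply, Module.Basis.constr_basis, hgy, Pi.basisFun_apply]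

/-- A homogeneous endomorphism that is the identity modulo the variables is bijective. -/
lemma bijective_of_constantCoeff_eq
    {θ : (ι → MvPolynomial σ k) →ₗ[MvPolynomial σ k] (ι → MvPolynomial σ k)}
    (hθ : ∀ b, IsHomogeneousVec deg (deg b) (θ (Pi.single b 1)))
    (h : ∀ b c, constantCoeff ((θ (Pi.single b 1) - Pi.single b 1 : ι → MvPolynomial σ k) c) = 0) :
    Function.Bijective θ := by
  cases nonempty_fintype ι
  refine OrzechProperty.bijective_of_surjective_endomorphism θ ?_
  -- Graded Nakayama by induction on the degree: the error `θ e_b - e_b` is homogeneous of degree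
  -- `deg b` without constant terms, so it only involves basis vectors of strictly smaller degree.
  have key : ∀ n b, deg b = n → Pi.single b 1 ∈ LinearMap.range θ := by
    intro n
    induction n using Nat.strong_induction_on with
    | _ n ih =>
      rintro b rfl
      have h1 : (Pi.single b 1 : ι → MvPolynomial σ k) =
          θ (Pi.single b 1) - (θ (Pi.single b 1) - Pi.single b 1) := by abel
      rw [h1]
      refine Submodule.sub_mem _ ⟨_, rfl⟩ ?_
      set x := θ (Pi.single b 1) - Pi.single b (1 : MvPolynomial σ k) with hx
      have hxh : IsHomogeneousVec deg (deg b) x :=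
        Submodule.sub_mem (vecGrading k σ deg (deg b)) (hθ b) (isHomogeneousVec_single deg b)
      rw [pi_eq_sum_univ' x]
      refine Submodule.sum_mem _ fun c _ => ?_
      by_cases hc : deg c < deg b
      · exact Submodule.smul_mem _ _ (ih _ hc c rfl)
      · have : x c = 0 := by
          ext m
          by_contra hm
          have h2 := hxh c m (by simpa using hm)
          have h3 : m = 0 := by
            rw [← Finsupp.degree_eq_zero_iff]
            omega
          subst h3
          refine hm ?_
          rw [coeff_zero, ← h b c, constantCoeff_eq]
        rw [this, zero_smul]
        exact zero_mem _
  rw [← LinearMap.range_eq_top, eq_top_iff]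
  intro x _
  rw [pi_eq_sum_univ' x]
  exact Submodule.sum_mem _ fun c _ => Submodule.smul_mem _ _ (key _ c rfl)

-- Since `f ∘ ψ ∘ φ = f`, the vector `ψ (φ e_b) - e_b` lies in the kernel of `f`, where minimality
-- rules out constant terms.
omit [Finite ι] [Finite κ] [DecidableEq κ] in
lemma IsMinimalCover.constantCoeff_sub (hf : IsMinimalCover 𝒩 deg f)
    {φ : (ι → MvPolynomial σ k) →ₗ[MvPolynomial σ k] (κ → MvPolynomial σ k)}
    {ψ : (κ → MvPolynomial σ k) →ₗ[MvPolynomial σ k] (ι → MvPolynomial σ k)}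
    (hφ : g ∘ₗ φ = f) (hψ : f ∘ₗ ψ = g) (b c : ι) :
    constantCoeff (((ψ ∘ₗ φ) (Pi.single b 1) - Pi.single b 1 : ι → MvPolynomial σ k) c) = 0 := by
  refine hf.constantCoeff_eq_zero _ ?_ c
  rw [map_sub, ← LinearMap.comp_apply, ← LinearMap.comp_assoc, hψ, hφ, sub_self]

omit [Finite ι] in
lemma isHomogeneousVec_comp
    {φ : (ι → MvPolynomial σ k) →ₗ[MvPolynomial σ k] (κ → MvPolynomial σ k)}
    {ψ : (κ → MvPolynomial σ k) →ₗ[MvPolynomial σ k] (ι → MvPolynomial σ k)}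
    (hφ : ∀ b, IsHomogeneousVec deg' (deg b) (φ (Pi.single b 1)))
    (hψ : ∀ b, IsHomogeneousVec deg (deg' b) (ψ (Pi.single b 1))) (b : ι) :
    IsHomogeneousVec deg (deg b) ((ψ ∘ₗ φ) (Pi.single b 1)) :=
  (isGradedFamily_vecGrading deg).apply_mem (f := ψ) hψ (hφ b)

/-- Minimal covers with the same image are isomorphic, and have generators in the same degrees. -/
lemma IsMinimalCover.exists_equiv (h𝒩 : IsGradedFamily (σ := σ) 𝒩)
    (hf : IsMinimalCover 𝒩 deg f) (hg : IsMinimalCover 𝒩 deg' g)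
    (h : LinearMap.range f = LinearMap.range g) :
    ∃ φ : (ι → MvPolynomial σ k) →ₗ[MvPolynomial σ k] (κ → MvPolynomial σ k),
      (∀ b, IsHomogeneousVec deg' (deg b) (φ (Pi.single b 1))) ∧ Function.Bijective φ ∧
      g ∘ₗ φ = f ∧ ∀ b, ∃ c, deg' c = deg b := by
  obtain ⟨φ, hφ, hgφ⟩ := h𝒩.exists_lift hf.apply_single_mem hg.apply_single_mem h.le
  obtain ⟨ψ, hψ, hfψ⟩ := h𝒩.exists_lift hg.apply_single_mem hf.apply_single_mem h.ge
  have h1 : Function.Bijective (ψ ∘ₗ φ) := bijective_of_constantCoeff_eq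
    (isHomogeneousVec_comp hφ hψ) (hf.constantCoeff_sub hgφ hfψ)
  have h2 : Function.Bijective (φ ∘ₗ ψ) := bijective_of_constantCoeff_eq
    (isHomogeneousVec_comp hψ hφ) (hg.constantCoeff_sub hfψ hgφ)
  rw [LinearMap.coe_comp] at h1 h2
  refine ⟨φ, hφ, ⟨h1.injective.of_comp, h2.surjective.of_comp⟩, hgφ, fun b => ?_⟩
  cases nonempty_fintype κ
  -- Modulo the variables `ψ ∘ φ` is the identity, so some entry of `φ e_b` has a nonzero constant
  -- term; homogeneity then forces the two degrees to agree.
  have h3 := hf.constantCoeff_sub hgφ hfψ b b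
  rw [LinearMap.comp_apply, linearMap_apply_eq_sum ψ] at h3
  have h4 : ∑ c, constantCoeff (φ (Pi.single b 1) c) * constantCoeff (ψ (Pi.single c 1) b) = 1 := by
    simpa [sub_eq_zero] using h3
  obtain ⟨c, -, hc⟩ := Finset.exists_ne_zero_of_sum_ne_zero (h4.trans_ne one_ne_zero)
  refine ⟨c, ?_⟩
  have := hφ b c 0 (by simpa [constantCoeff_eq] using left_ne_zero_of_mul hc)
  simpa using this

/-- A finite family of homogeneous elements can be shrunk to one that gives a minimal cover of the
same submodule. -/
lemma IsGradedFamily.exists_isMinimalCover (h𝒩 : IsGradedFamily (σ := σ) 𝒩) (n : ℕ)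
    (d : Fin n → ℕ) (v : Fin n → N) (hv : ∀ b, v b ∈ 𝒩 (d b)) :
    ∃ (n' : ℕ) (d' : Fin n' → ℕ) (f : (Fin n' → MvPolynomial σ k) →ₗ[MvPolynomial σ k] N),
      IsMinimalCover 𝒩 d' f ∧
        LinearMap.range f = Submodule.span (MvPolynomial σ k) (Set.range v) := by
  induction n with
  | zero =>
    refine ⟨0, d, 0, ⟨fun b => b.elim0, fun x _ c => c.elim0⟩, ?_⟩
    simp
  | succ n ih =>
    have hf : ∀ b, Fintype.linearCombination (MvPolynomial σ k) v (Pi.single b 1) ∈ 𝒩 (d b) := by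
      intro b
      rw [Fintype.linearCombination_apply_single, one_smul]
      exact hv b
    by_cases hmin : ∀ x, Fintype.linearCombination (MvPolynomial σ k) v x = 0 →
        ∀ c, constantCoeff (x c) = 0
    · exact ⟨n + 1, d, _, ⟨hf, hmin⟩, Fintype.range_linearCombination _ _⟩
    · push Not at hmin
      obtain ⟨x, hx, c, hc⟩ := hmin
      obtain ⟨n', d', f, hmc, hr⟩ := ih (d ∘ c.succAbove) (v ∘ c.succAbove) fun b => hv _
      refine ⟨n', d', f, hmc, hr.trans (le_antisymm ?_ ?_)⟩
      · exact Submodule.span_mono (Set.range_comp_subset_range _ _)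
      · rw [Submodule.span_le]
        rintro _ ⟨b, rfl⟩
        rcases Fin.eq_self_or_eq_succAbove c b with rfl | ⟨b', rfl⟩
        -- In the component of degree `d b` of the relation `x`, the entry at `b` is a nonzero
        -- constant, so `v b` can be expressed through the other generators.
        · have hy := h𝒩.vecComponent_mem_ker hf hx (d b)
          set y := vecComponent d (d b) x with hy_def
          classical
          have hyb : y b = C (constantCoeff (x b)) := by
            ext m
            rw [hy_def, coeff_vecComponent, coeff_C]
            by_cases hm : m = 0
            · subst hm; simp [constantCoeff_eq]
            · rw [if_neg (by rw [← Finsupp.degree_eq_zero_iff] at hm; omega),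
                if_neg fun h => hm h.symm]
          rw [Fintype.linearCombination_apply, Fin.sum_univ_succAbove _ b, hyb] at hy
          have h1 : (C (constantCoeff (x b))⁻¹ : MvPolynomial σ k) •
              (C (constantCoeff (x b)) : MvPolynomial σ k) • v b = v b := by
            rw [smul_smul, ← C_mul, inv_mul_cancel₀ hc, C_1, one_smul]
          rw [SetLike.mem_coe, ← h1, eq_neg_of_add_eq_zero_left hy]
          refine Submodule.smul_mem _ _ (Submodule.neg_mem _ (Submodule.sum_mem _ fun i _ =>
            Submodule.smul_mem _ _ (Submodule.subset_span ⟨i, rfl⟩)))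
        · exact Submodule.subset_span ⟨b', rfl⟩

/-- The kernel of a homogeneous map has a minimal cover. -/
lemma IsGradedFamily.exists_isMinimalCover_ker [Finite σ] (h𝒩 : IsGradedFamily (σ := σ) 𝒩)
    (hf : ∀ b, f (Pi.single b 1) ∈ 𝒩 (deg b)) :
    ∃ (n' : ℕ) (d' : Fin n' → ℕ)
      (g : (Fin n' → MvPolynomial σ k) →ₗ[MvPolynomial σ k] (ι → MvPolynomial σ k)),
      IsMinimalCover (vecGrading k σ deg) d' g ∧ LinearMap.range g = LinearMap.ker f := by
  -- Hilbert's basis theorem gives finitely many generators, not necessarily homogeneous. They are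
  -- replaced by their finitely many homogeneous components, indexed by `T`, which stay in the
  -- kernel.
  obtain ⟨s, hs⟩ := IsNoetherian.noetherian (LinearMap.ker f)
  choose n₀ hn₀ using fun x : ι → MvPolynomial σ k => sum_vecComponent deg x
  let T := Σ x : s, Fin (n₀ x)
  let e : Fin (Fintype.card T) ≃ T := (Fintype.equivFin T).symm
  have hv (t : T) : f (vecComponent deg t.2 (t.1 : ι → MvPolynomial σ k)) = 0 := by
    refine h𝒩.vecComponent_mem_ker hf ?_ _
    rw [← LinearMap.mem_ker, ← hs]
    exact Submodule.subset_span t.1.2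
  obtain ⟨n', d', g, hg, hr⟩ := (isGradedFamily_vecGrading (k := k) (σ := σ) deg).exists_isMinimalCover
    (Fintype.card T) (fun i => (e i).2)
    (fun i => vecComponent deg (e i).2 ((e i).1 : ι → MvPolynomial σ k))
    (fun i => isHomogeneousVec_vecComponent _ _ _)
  refine ⟨n', d', g, hg, hr.trans (le_antisymm ?_ ?_)⟩
  · rw [Submodule.span_le]
    rintro _ ⟨i, rfl⟩
    exact hv (e i)
  · rw [← hs, Submodule.span_le]
    intro x hx
    rw [SetLike.mem_coe, ← hn₀ x _ le_rfl, Finset.sum_range]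
    refine Submodule.sum_mem _ fun j _ => Submodule.subset_span ⟨e.symm ⟨⟨x, hx⟩, j⟩, ?_⟩
    change vecComponent deg (e (e.symm _)).2 ((e (e.symm _)).1 : ι → MvPolynomial σ k) = _
    rw [Equiv.apply_symm_apply]

end MinimalCovers

end

noncomputable section

/-! ### Existence of minimal graded free resolutions by iterated syzygies. -/

section Existence

variable {k : Type*} [Field k] {σ : Type*} [Finite σ]

/-- A submodule of a graded free module that has a minimal cover. -/
structure SyzygyModule (k : Type*) [Field k] (σ : Type*) where
  rank : ℕ
  deg : Fin rank → ℕ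
  carrier : Submodule (MvPolynomial σ k) (Fin rank → MvPolynomial σ k)
  exists_cover : ∃ (n : ℕ) (d : Fin n → ℕ)
    (g : (Fin n → MvPolynomial σ k) →ₗ[MvPolynomial σ k] (Fin rank → MvPolynomial σ k)),
    IsMinimalCover (vecGrading k σ deg) d g ∧ LinearMap.range g = carrier

namespace SyzygyModule

/-- The rank of a chosen minimal cover. -/
def coverRank (s : SyzygyModule k σ) : ℕ := s.exists_cover.choose

/-- The degrees of the generators of a chosen minimal cover. -/
def coverDeg (s : SyzygyModule k σ) : Fin s.coverRank → ℕ := s.exists_cover.choose_spec.choose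

/-- A chosen minimal cover. -/
def cover (s : SyzygyModule k σ) :
    (Fin s.coverRank → MvPolynomial σ k) →ₗ[MvPolynomial σ k] (Fin s.rank → MvPolynomial σ k) :=
  s.exists_cover.choose_spec.choose_spec.choose

omit [Finite σ] in
lemma isMinimalCover_cover (s : SyzygyModule k σ) :
    IsMinimalCover (vecGrading k σ s.deg) s.coverDeg s.cover :=
  s.exists_cover.choose_spec.choose_spec.choose_spec.1

omit [Finite σ] in
lemma range_cover (s : SyzygyModule k σ) : LinearMap.range s.cover = s.carrier :=
  s.exists_cover.choose_spec.choose_spec.choose_spec.2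

/-- The kernel of the chosen minimal cover. -/
def next (s : SyzygyModule k σ) : SyzygyModule k σ where
  rank := s.coverRank
  deg := s.coverDeg
  carrier := LinearMap.ker s.cover
  exists_cover := (isGradedFamily_vecGrading s.deg).exists_isMinimalCover_ker
    s.isMinimalCover_cover.apply_single_mem

lemma exact_cover_next (s : SyzygyModule k σ) : Function.Exact s.next.cover s.cover :=
  LinearMap.exact_iff.2 s.next.range_cover.symm

/-- The iterated syzygy modules. -/
def iter (s : SyzygyModule k σ) : ℕ → SyzygyModule k σ
  | 0 => s
  | i + 1 => (s.iter i).next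

end SyzygyModule

variable {M : Type*} [AddCommGroup M] [Module k M] [Module (MvPolynomial σ k) M]
  {ℳ : ℕ → Submodule k M}

/-- A graded module generated by finitely many homogeneous elements has a minimal graded free
resolution. -/
lemma IsGradedFamily.nonempty_resolution (hℳ : IsGradedFamily (σ := σ) ℳ) {n : ℕ}
    (d : Fin n → ℕ) (v : Fin n → M) (hv : ∀ b, v b ∈ ℳ (d b))
    (hspan : Submodule.span (MvPolynomial σ k) (Set.range v) = ⊤) :
    Nonempty (MinimalGradedFreeResolution k σ ℳ) := by
  obtain ⟨n', d', f, hf, hr⟩ := hℳ.exists_isMinimalCover n d v hv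
  -- The ambient free module of the `i`-th iterate of `s` becomes the `i`-th term of the resolution,
  -- and its carrier is the image of the `i`-th differential.
  let s : SyzygyModule k σ :=
    ⟨n', d', LinearMap.ker f, hℳ.exists_isMinimalCover_ker hf.apply_single_mem⟩
  have hs : ∀ i, ∀ x ∈ (s.iter i).carrier, ∀ c, constantCoeff (x c) = 0 := by
    rintro (_ | i)
    · exact hf.constantCoeff_eq_zero
    · exact (s.iter i).isMinimalCover_cover.constantCoeff_eq_zero
  have hexact : Function.Exact s.cover f := LinearMap.exact_iff.2 s.range_cover.symm
  have hsurj : Function.Surjective f := LinearMap.range_eq_top.1 (hr.trans hspan)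
  exact ⟨{
    rank := fun i => (s.iter i).rank
    deg := fun i => (s.iter i).deg
    d := fun i => (s.iter i).cover
    aug := f
    aug_homogeneous := hf.apply_single_mem
    d_homogeneous := fun i => (s.iter i).isMinimalCover_cover.apply_single_mem
    aug_surjective := hsurj
    exact_aug := hexact
    exact_d := fun i => (s.iter i).exact_cover_next
    minimal := fun i b => hs i _ <| by
      rw [← (s.iter i).range_cover]
      exact ⟨_, rfl⟩ }⟩

end Existence

/-! ### Uniqueness of minimal resolutions, and the regularity. -/

section Uniqueness

variable {k : Type*} [Field k] {σ : Type*} {M : Type*} [AddCommGroup M] [Module k M]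
  [Module (MvPolynomial σ k) M] {ℳ : ℕ → Submodule k M}

lemma map_ker_of_comp_eq {R A B C : Type*} [CommRing R] [AddCommGroup A] [AddCommGroup B]
    [AddCommGroup C] [Module R A] [Module R B] [Module R C] {f : A →ₗ[R] C} {g : B →ₗ[R] C}
    {φ : A →ₗ[R] B} (hφ : Function.Surjective φ) (h : g ∘ₗ φ = f) :
    (LinearMap.ker f).map φ = LinearMap.ker g := by
  subst h
  rw [LinearMap.ker_comp, Submodule.map_comap_eq_of_surjective hφ]

namespace MinimalGradedFreeResolution

lemma constantCoeff_d (F : MinimalGradedFreeResolution k σ ℳ) (i : ℕ)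
    (x : Fin (F.rank (i + 1)) → MvPolynomial σ k) (c : Fin (F.rank i)) :
    constantCoeff (F.d i x c) = 0 := by
  rw [linearMap_apply_eq_sum, Finset.sum_apply, map_sum]
  refine Finset.sum_eq_zero fun b _ => ?_
  rw [Pi.smul_apply, smul_eq_mul, map_mul, F.minimal, mul_zero]

lemma isMinimalCover_aug (F : MinimalGradedFreeResolution k σ ℳ) :
    IsMinimalCover ℳ (F.deg 0) F.aug where
  apply_single_mem := F.aug_homogeneous
  constantCoeff_eq_zero x hx c := by
    obtain ⟨y, rfl⟩ := (F.exact_aug x).1 hx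
    exact F.constantCoeff_d 0 y c

lemma constantCoeff_of_d_eq_zero (F : MinimalGradedFreeResolution k σ ℳ) (i : ℕ)
    (x : Fin (F.rank (i + 1)) → MvPolynomial σ k) (hx : F.d i x = 0) (c) :
    constantCoeff (x c) = 0 := by
  obtain ⟨y, rfl⟩ := (F.exact_d i x).1 hx
  exact F.constantCoeff_d (i + 1) y c

lemma isMinimalCover_d (F : MinimalGradedFreeResolution k σ ℳ) (i : ℕ) :
    IsMinimalCover (vecGrading k σ (F.deg i)) (F.deg (i + 1)) (F.d i) where
  apply_single_mem := F.d_homogeneous i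
  constantCoeff_eq_zero := F.constantCoeff_of_d_eq_zero i

/-- Once `φ` matches the images of the `i`-th differentials, `φ ∘ F.d i` and `F'.d i` are minimal
covers of the same submodule, and uniqueness of minimal covers gives the next isomorphism. The
statement about ranges is what the induction carries; the agreement of degrees is what is used
afterwards. -/
lemma exists_comparison (hℳ : IsGradedFamily (σ := σ) ℳ)
    (F F' : MinimalGradedFreeResolution k σ ℳ) (i : ℕ) :
    ∃ φ : (Fin (F.rank i) → MvPolynomial σ k) →ₗ[MvPolynomial σ k]
        (Fin (F'.rank i) → MvPolynomial σ k),
      (∀ b, IsHomogeneousVec (F'.deg i) (F.deg i b) (φ (Pi.single b 1))) ∧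
      Function.Bijective φ ∧ (LinearMap.range (F.d i)).map φ = LinearMap.range (F'.d i) ∧
      ∀ b, ∃ c, F'.deg i c = F.deg i b := by
  induction i with
  | zero =>
    obtain ⟨φ, h1, h2, h3, h4⟩ := F.isMinimalCover_aug.exists_equiv hℳ F'.isMinimalCover_aug
      ((LinearMap.range_eq_top.2 F.aug_surjective).trans
        (LinearMap.range_eq_top.2 F'.aug_surjective).symm)
    refine ⟨φ, h1, h2, ?_, h4⟩
    rw [← LinearMap.exact_iff.1 F.exact_aug, ← LinearMap.exact_iff.1 F'.exact_aug]
    exact map_ker_of_comp_eq h2.surjective h3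
  | succ i ih =>
    obtain ⟨φ, h1, h2, h3, -⟩ := ih
    have hc : IsMinimalCover (vecGrading k σ (F'.deg i)) (F.deg (i + 1)) (φ ∘ₗ F.d i) :=
      { apply_single_mem := fun b =>
          (isGradedFamily_vecGrading (F'.deg i)).apply_mem h1 (F.d_homogeneous i b)
        constantCoeff_eq_zero := fun x hx =>
          F.constantCoeff_of_d_eq_zero i x (h2.injective (by simpa using hx)) }
    obtain ⟨ψ, h1', h2', h3', h4'⟩ := hc.exists_equiv (isGradedFamily_vecGrading (F'.deg i))
      (F'.isMinimalCover_d i) (by rw [LinearMap.range_comp, h3])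
    refine ⟨ψ, h1', h2', ?_, h4'⟩
    rw [← LinearMap.exact_iff.1 (F.exact_d i), ← LinearMap.exact_iff.1 (F'.exact_d i),
      ← map_ker_of_comp_eq h2'.surjective h3', LinearMap.ker_comp_of_ker_eq_bot]
    exact LinearMap.ker_eq_bot.2 h2.injective

/-- All minimal resolutions have the same set of generator degrees at each stage. Multiplicities
need not be compared, since the regularity only sees which Betti numbers vanish. -/
lemma gradedBetti_ne_zero_iff (hℳ : IsGradedFamily (σ := σ) ℳ)
    (F : MinimalGradedFreeResolution k σ ℳ) (i j : ℕ) :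
    gradedBetti k σ ℳ i j ≠ 0 ↔ ∃ b, F.deg i b = j := by
  have key (F' : MinimalGradedFreeResolution k σ ℳ) :
      (Nat.card {b : Fin (F'.rank i) // F'.deg i b = j} : ℕ∞) ≠ 0 ↔ ∃ b, F'.deg i b = j := by
    rw [Nat.cast_ne_zero, Nat.card_ne_zero, nonempty_subtype]
    exact and_iff_left inferInstance
  rw [gradedBetti, ne_eq, ENat.iSup_eq_zero, not_forall]
  constructor
  · rintro ⟨F', hF'⟩
    obtain ⟨b, rfl⟩ := (key F').1 hF'
    obtain ⟨-, -, -, -, h⟩ := exists_comparison hℳ F' F i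
    exact h b
  · exact fun h => ⟨F, (key F).2 h⟩

/-- The regularity can be read off from any minimal graded free resolution. -/
lemma regularity_eq (hℳ : IsGradedFamily (σ := σ) ℳ) (F : MinimalGradedFreeResolution k σ ℳ) :
    regularity k σ ℳ = ⨆ b : Σ i, Fin (F.rank i),
      ((((F.deg b.1 b.2 : ℤ) - (b.1 : ℤ) : ℤ) : WithTop ℤ) : WithBot (WithTop ℤ)) := by
  unfold regularity
  simp_rw [gradedBetti_ne_zero_iff hℳ F]
  refine le_antisymm ?_ ?_
  · refine iSup_le fun i => iSup_le fun j => iSup_le ?_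
    rintro ⟨b, rfl⟩
    exact le_iSup (fun b : Σ i, Fin (F.rank i) =>
      ((((F.deg b.1 b.2 : ℤ) - (b.1 : ℤ) : ℤ) : WithTop ℤ) : WithBot (WithTop ℤ))) ⟨i, b⟩
  · refine iSup_le fun b => ?_
    exact le_iSup_of_le b.1 (le_iSup_of_le (F.deg b.1 b.2) (le_iSup_of_le ⟨b.2, rfl⟩ le_rfl))

end MinimalGradedFreeResolution

end Uniqueness

end

noncomputable section

/-! ### Projective dimension from a minimal resolution. -/

section ProjectiveDimension

open CategoryTheory

universe u

/-- Dimension shifting along an exact sequence of modules with projective middle term. -/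
lemma hasProjectiveDimensionLT_range_iff {R : Type u} [CommRing R] {Q P N : Type u}
    [AddCommGroup Q] [AddCommGroup P] [AddCommGroup N] [Module R Q] [Module R P] [Module R N]
    [Module.Projective R P] {g : Q →ₗ[R] P} {f : P →ₗ[R] N} (h : Function.Exact g f) (n : ℕ) :
    HasProjectiveDimensionLT (ModuleCat.of R (LinearMap.range f)) (n + 2) ↔
      HasProjectiveDimensionLT (ModuleCat.of R (LinearMap.range g)) (n + 1) := by
  have hex : Function.Exact (LinearMap.range g).subtype f.rangeRestrict := by
    rw [LinearMap.exact_iff, LinearMap.ker_rangeRestrict, Submodule.range_subtype,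
      LinearMap.exact_iff.1 h]
  let S : ShortComplex (ModuleCat.{u} R) :=
    ShortComplex.mk (ModuleCat.ofHom (LinearMap.range g).subtype)
      (ModuleCat.ofHom f.rangeRestrict) (by
        ext x
        exact congrArg Subtype.val (hex.apply_apply_eq_zero x))
  have hS : S.ShortExact := ModuleCat.shortComplex_shortExact S hex
    (LinearMap.range g).injective_subtype f.surjective_rangeRestrict
  exact hS.hasProjectiveDimensionLT_X₃_iff n
    (inferInstanceAs (Projective (ModuleCat.of R P)))

/-- A map from a finite free module over `k[σ]` onto a projective module is injective if its kernel
has no entries with a nonzero constant term. -/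
lemma injective_of_projective_range {k : Type*} [Field k] {σ : Type*} {N : Type*} [AddCommGroup N]
    [Module (MvPolynomial σ k) N] {n : ℕ}
    (f : (Fin n → MvPolynomial σ k) →ₗ[MvPolynomial σ k] N)
    (hf : ∀ x, f x = 0 → ∀ c, constantCoeff (x c) = 0)
    [Module.Projective (MvPolynomial σ k) (LinearMap.range f)] : Function.Injective f := by
  obtain ⟨s, hs⟩ := f.rangeRestrict.exists_rightInverse_of_surjective f.range_rangeRestrict
  set p := s ∘ₗ f.rangeRestrict with hp
  have hfp (x) : f (p x) = f x := by
    exact congrArg Subtype.val (LinearMap.congr_fun hs (f.rangeRestrict x))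
  have hpp : p * p = p := by
    refine LinearMap.ext fun x => ?_
    exact congrArg s (Subtype.ext (hfp x))
  -- `p` is an idempotent that is the identity modulo the variables. Its determinant is an
  -- idempotent of a domain with constant term `1`, hence equal to `1`, and an invertible idempotent
  -- is the identity.
  have hdet : LinearMap.det p = 1 := by
    have h1 : LinearMap.det p * LinearMap.det p = LinearMap.det p := by
      rw [← map_mul, hpp]
    refine (mul_eq_left₀ ?_).1 h1
    intro h0
    have h2 : constantCoeff (LinearMap.det p) = 1 := by
      rw [← LinearMap.det_toMatrix', RingHom.map_det]
      convert Matrix.det_one (n := Fin n) (R := k)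
      ext i j
      have := hf (p (Pi.single j 1) - Pi.single j 1) (by rw [map_sub, hfp, sub_self]) i
      rw [Pi.sub_apply, map_sub, sub_eq_zero] at this
      simp only [RingHom.mapMatrix_apply, Matrix.map_apply, LinearMap.toMatrix'_apply]
      convert this using 1
      rw [Matrix.one_apply, Pi.single_apply]
      split_ifs <;> simp
    rw [h0, map_zero] at h2
    exact zero_ne_one h2
  have hu : IsUnit p := by
    rw [LinearMap.isUnit_iff_isUnit_det, hdet]
    exact isUnit_one
  have h1 : p = 1 := hu.mul_left_cancel (by rw [hpp, mul_one])
  intro x y hxy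
  have h2 : p x = p y := congrArg s (Subtype.ext hxy)
  simpa [h1] using h2

namespace MinimalGradedFreeResolution

variable {k : Type*} [Field k] {σ : Type*} {M : Type*} [AddCommGroup M] [Module k M]
  [Module (MvPolynomial σ k) M] {ℳ : ℕ → Submodule k M}

/-- Otherwise the all-ones vector would be a cycle with nonzero constant terms, against minimality.
-/
lemma rank_succ_eq_zero_of_d_eq_zero (F : MinimalGradedFreeResolution k σ ℳ) {i : ℕ}
    (h : F.d i = 0) : F.rank (i + 1) = 0 := by
  by_contra h0
  have h1 := F.constantCoeff_of_d_eq_zero i 1 (by rw [h, LinearMap.zero_apply])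
    ⟨0, Nat.pos_of_ne_zero h0⟩
  simp at h1

lemma rank_eq_zero_of_le (F : MinimalGradedFreeResolution k σ ℳ) {i j : ℕ} (hij : i ≤ j)
    (h : F.rank i = 0) : F.rank j = 0 := by
  induction j, hij using Nat.le_induction with
  | base => exact h
  | succ j _ ih =>
    refine F.rank_succ_eq_zero_of_d_eq_zero ?_
    ext x c
    exact (Fin.cast ih c).elim0

end MinimalGradedFreeResolution

namespace MinimalGradedFreeResolution

universe v w

variable {k : Type v} [Field k] {σ : Type w} {M : Type (max v w)} [AddCommGroup M] [Module k M]
  [Module (MvPolynomial σ k) M] {ℳ : ℕ → Submodule k M}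

/-- If the image of `f` is projective, minimality makes `f` injective, so the preceding differential
vanishes and with it the next free module. Conversely, if that module is zero, the image of `f` is
free. -/
lemma hasProjectiveDimensionLT_one_range_iff {N : Type (max v w)} [AddCommGroup N]
    [Module (MvPolynomial σ k) N] (F : MinimalGradedFreeResolution k σ ℳ) (i : ℕ)
    {f : (Fin (F.rank i) → MvPolynomial σ k) →ₗ[MvPolynomial σ k] N}
    (hex : Function.Exact (F.d i) f) :
    HasProjectiveDimensionLT (ModuleCat.of (MvPolynomial σ k) (LinearMap.range f)) 1 ↔
      F.rank (i + 1) = 0 := by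
  rw [← projective_iff_hasProjectiveDimensionLT_one, ← IsProjective.iff_projective]
  constructor
  · intro h
    have := injective_of_projective_range f fun x hx c => by
      obtain ⟨y, rfl⟩ := (hex x).1 hx
      exact F.constantCoeff_d i y c
    refine F.rank_succ_eq_zero_of_d_eq_zero (LinearMap.ext fun x => this ?_)
    rw [hex.apply_apply_eq_zero, LinearMap.zero_apply, map_zero]
  · intro h
    have hinj : Function.Injective f := by
      rw [← LinearMap.ker_eq_bot, LinearMap.exact_iff.1 hex, LinearMap.range_eq_bot]
      refine LinearMap.pi_ext' fun c => (Fin.cast h c).elim0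
    exact Module.Projective.of_equiv (LinearEquiv.ofInjective f hinj)

lemma hasProjectiveDimensionLT_range_d_iff (F : MinimalGradedFreeResolution k σ ℳ) (n i : ℕ) :
    HasProjectiveDimensionLT (ModuleCat.of (MvPolynomial σ k) (LinearMap.range (F.d i))) (n + 1) ↔
      F.rank (i + n + 2) = 0 := by
  induction n generalizing i with
  | zero => exact F.hasProjectiveDimensionLT_one_range_iff (i + 1) (F.exact_d i)
  | succ n ih =>
    rw [hasProjectiveDimensionLT_range_iff (F.exact_d i), ih (i + 1),
      show i + 1 + n + 2 = i + (n + 1) + 2 by ring]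

/-- Dimension shifting reduces the bound to projectivity of the `n`-th syzygy, which for a minimal
resolution means that the next free module is zero. -/
lemma hasProjectiveDimensionLE_iff (F : MinimalGradedFreeResolution k σ ℳ) (n : ℕ) :
    HasProjectiveDimensionLE (ModuleCat.of (MvPolynomial σ k) M) n ↔ F.rank (n + 1) = 0 := by
  have e : ModuleCat.of (MvPolynomial σ k) (LinearMap.range F.aug) ≅
      ModuleCat.of (MvPolynomial σ k) M :=
    (LinearEquiv.ofTop _ (LinearMap.range_eq_top.2 F.aug_surjective)).toModuleIso
  have h : HasProjectiveDimensionLE (ModuleCat.of (MvPolynomial σ k) M) n ↔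
      HasProjectiveDimensionLE (ModuleCat.of (MvPolynomial σ k) (LinearMap.range F.aug)) n :=
    ⟨fun _ => hasProjectiveDimensionLT_of_iso e.symm _, fun _ => hasProjectiveDimensionLT_of_iso e _⟩
  rw [h]
  cases n with
  | zero => exact F.hasProjectiveDimensionLT_one_range_iff 0 F.exact_aug
  | succ n =>
    rw [HasProjectiveDimensionLE, hasProjectiveDimensionLT_range_iff F.exact_aug,
      F.hasProjectiveDimensionLT_range_d_iff n 0, zero_add]

/-- The projective dimension can be read off from any minimal graded free resolution. -/
lemma projectiveDimension_eq [Nontrivial M] (F : MinimalGradedFreeResolution k σ ℳ) :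
    projectiveDimension (ModuleCat.of (MvPolynomial σ k) M) =
      ⨆ b : Σ i, Fin (F.rank i), ((b.1 : ℕ∞) : WithBot ℕ∞) := by
  -- Two elements of `WithBot ℕ∞` other than `⊥` are equal as soon as the same natural numbers bound
  -- them.
  have hle (n : ℕ) : projectiveDimension (ModuleCat.of (MvPolynomial σ k) M) ≤ n ↔
      (⨆ b : Σ i, Fin (F.rank i), ((b.1 : ℕ∞) : WithBot ℕ∞)) ≤ n := by
    rw [projectiveDimension_le_iff, F.hasProjectiveDimensionLE_iff, iSup_le_iff]
    constructor
    · rintro h ⟨i, b⟩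
      by_contra hi
      have : n + 1 ≤ i := by
        by_contra h'
        exact hi (by exact_mod_cast (show i ≤ n by omega))
      exact (Fin.cast (F.rank_eq_zero_of_le this h) b).elim0
    · intro h
      by_contra h0
      have := h ⟨n + 1, ⟨0, Nat.pos_of_ne_zero h0⟩⟩
      have : n + 1 ≤ n := by exact_mod_cast this
      omega
  have h0 : F.rank 0 ≠ 0 := by
    intro h0
    obtain ⟨x, hx⟩ := exists_ne (0 : M)
    obtain ⟨y, rfl⟩ := F.aug_surjective x
    refine hx ?_
    rw [linearMap_apply_eq_sum]
    exact Finset.sum_eq_zero fun c _ => (Fin.cast h0 c).elim0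
  have hbot : projectiveDimension (ModuleCat.of (MvPolynomial σ k) M) ≠ ⊥ := by
    rw [ne_eq, projectiveDimension_eq_bot_iff, ModuleCat.isZero_iff_subsingleton]
    exact not_subsingleton M
  have hbot' : (⨆ b : Σ i, Fin (F.rank i), ((b.1 : ℕ∞) : WithBot ℕ∞)) ≠ ⊥ := by
    intro h
    have := le_iSup (fun b : Σ i, Fin (F.rank i) => ((b.1 : ℕ∞) : WithBot ℕ∞))
      ⟨0, ⟨0, Nat.pos_of_ne_zero h0⟩⟩
    rw [h, le_bot_iff] at this
    exact WithBot.coe_ne_bot this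
  generalize projectiveDimension (ModuleCat.of (MvPolynomial σ k) M) = a at *
  generalize (⨆ b : Σ i, Fin (F.rank i), ((b.1 : ℕ∞) : WithBot ℕ∞)) = b at *
  lift a to ℕ∞ using hbot
  lift b to ℕ∞ using hbot'
  refine le_antisymm ?_ ?_
  · cases b with
    | top => exact le_top
    | coe n => exact (hle n).2 le_rfl
  · cases a with
    | top => exact le_top
    | coe n => exact (hle n).1 le_rfl

end MinimalGradedFreeResolution

end ProjectiveDimension

end

noncomputable section

/-! ### Resolutions as a single free module with a differential. -/

section Fibers

variable {R : Type*} [CommRing R] {B : Type*} {hdeg : B → ℕ} {n : ℕ} {ι : Type*} [Fintype ι]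
  (e : ι ≃ {b // hdeg b = n})

/-- The inclusion of the free module on the basis elements of degree `n`. -/
def fiberInc : (ι → R) →ₗ[R] (B →₀ R) :=
  Fintype.linearCombination R fun i => Finsupp.single (e i : B) 1

/-- The projection to the free module on the basis elements of degree `n`. -/
def fiberProj : (B →₀ R) →ₗ[R] (ι → R) :=
  LinearMap.pi fun i => Finsupp.lapply (e i : B)

omit [Fintype ι] in
@[simp] lemma fiberProj_apply (y : B →₀ R) (i : ι) : fiberProj e y i = y (e i) := rfl

@[simp] lemma fiberInc_single [DecidableEq ι] (i : ι) :
    fiberInc e (Pi.single i (1 : R)) = Finsupp.single (e i : B) 1 := by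
  rw [fiberInc, Fintype.linearCombination_apply_single, one_smul]

@[simp] lemma fiberInc_apply (x : ι → R) (i : ι) : fiberInc e x (e i) = x i := by
  classical
  rw [fiberInc, Fintype.linearCombination_apply, Finsupp.finsetSum_apply, Finset.sum_eq_single i]
  · simp
  · intro j _ hj
    rw [Finsupp.smul_apply, Finsupp.single_eq_of_ne, smul_zero]
    exact fun h => hj (e.injective (Subtype.ext h)).symm
  · simp

lemma fiberInc_apply_of_ne (x : ι → R) {b : B} (hb : hdeg b ≠ n) : fiberInc e x b = 0 := by
  classical
  rw [fiberInc, Fintype.linearCombination_apply, Finsupp.finsetSum_apply]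
  refine Finset.sum_eq_zero fun j _ => ?_
  rw [Finsupp.smul_apply, Finsupp.single_eq_of_ne, smul_zero]
  rintro rfl
  exact hb (e j).2

lemma hdeg_eq_of_fiberInc_ne_zero {x : ι → R} {b : B} (hb : fiberInc e x b ≠ 0) : hdeg b = n := by
  by_contra h
  exact hb (fiberInc_apply_of_ne e x h)

@[simp] lemma fiberProj_fiberInc (x : ι → R) : fiberProj e (fiberInc e x) = x := by
  ext i
  simp

lemma fiberInc_fiberProj_apply (y : B →₀ R) {b : B} (hb : hdeg b = n) :
    fiberInc e (fiberProj e y) b = y b := by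
  obtain ⟨i, hi⟩ := e.surjective ⟨b, hb⟩
  obtain rfl : (e i : B) = b := congrArg Subtype.val hi
  simp

lemma fiberInc_fiberProj {y : B →₀ R} (hy : ∀ b, y b ≠ 0 → hdeg b = n) :
    fiberInc e (fiberProj e y) = y := by
  ext b
  by_cases hb : hdeg b = n
  · rw [fiberInc_fiberProj_apply e y hb]
  · rw [fiberInc_apply_of_ne e _ hb]
    by_contra h
    exact hb (hy b (Ne.symm h))

omit [Fintype ι] in
lemma fiberProj_eq_zero {y : B →₀ R} (hy : ∀ b, y b ≠ 0 → hdeg b ≠ n) : fiberProj e y = 0 := by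
  ext i
  by_contra h
  exact hy _ h (e i).2

end Fibers

lemma finsupp_linearMap_eq_sum {R B N : Type*} [CommRing R] [AddCommGroup N] [Module R N]
    (f : (B →₀ R) →ₗ[R] N) (x : B →₀ R) : f x = x.sum fun b a => a • f (Finsupp.single b 1) := by
  conv_lhs => rw [← Finsupp.sum_single x]
  rw [Finsupp.sum, map_sum]
  refine Finset.sum_congr rfl fun b _ => ?_
  simp only [← map_smul, Finsupp.smul_single, smul_eq_mul, mul_one]

/-- A minimal graded free resolution, written as one free module with a differential. The basis
vector `b` has homological degree `hdeg b` and internal degree `deg b`. -/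
structure TotalResolution (k : Type*) [Field k] (σ : Type*) {M : Type*}
    [AddCommGroup M] [Module k M] [Module (MvPolynomial σ k) M] (ℳ : ℕ → Submodule k M) where
  B : Type
  hdeg : B → ℕ
  deg : B → ℕ
  finite_fiber : ∀ n, Finite {b // hdeg b = n}
  D : (B →₀ MvPolynomial σ k) →ₗ[MvPolynomial σ k] (B →₀ MvPolynomial σ k)
  aug : (B →₀ MvPolynomial σ k) →ₗ[MvPolynomial σ k] M
  D_hdeg : ∀ b c, D (Finsupp.single b 1) c ≠ 0 → hdeg c + 1 = hdeg b
  D_homogeneous : ∀ b, IsHomogeneousVec deg (deg b) (D (Finsupp.single b 1))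
  D_minimal : ∀ b c, constantCoeff (D (Finsupp.single b 1) c) = 0
  aug_hdeg : ∀ b, hdeg b ≠ 0 → aug (Finsupp.single b 1) = 0
  aug_homogeneous : ∀ b, aug (Finsupp.single b 1) ∈ ℳ (deg b)
  aug_surjective : Function.Surjective aug
  aug_D : ∀ x, aug (D x) = 0
  D_D : ∀ x, D (D x) = 0
  exact : ∀ x, D x = 0 → aug x = 0 → ∃ y, D y = x

variable {k : Type*} [Field k] {σ : Type*} {M : Type*}
    [AddCommGroup M] [Module k M] [Module (MvPolynomial σ k) M] {ℳ : ℕ → Submodule k M}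

namespace TotalResolution

variable (T : TotalResolution k σ ℳ)

lemma exists_of_D_ne_zero {x : T.B →₀ MvPolynomial σ k} {c : T.B} (h : T.D x c ≠ 0) :
    ∃ b, x b ≠ 0 ∧ T.hdeg c + 1 = T.hdeg b := by
  rw [finsupp_linearMap_eq_sum, Finsupp.sum, Finsupp.finsetSum_apply] at h
  obtain ⟨b, hb, hne⟩ := Finset.exists_ne_zero_of_sum_ne_zero h
  exact ⟨b, by simpa using hb, T.D_hdeg b c (right_ne_zero_of_mul hne)⟩

lemma aug_eq_zero {x : T.B →₀ MvPolynomial σ k} (h : ∀ b, x b ≠ 0 → T.hdeg b ≠ 0) :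
    T.aug x = 0 := by
  rw [finsupp_linearMap_eq_sum]
  refine Finset.sum_eq_zero fun b hb => ?_
  simp only [T.aug_hdeg b (h b (by simpa using hb)), smul_zero]

/-- The number of basis elements of homological degree `n`. -/
def rank (n : ℕ) : ℕ := Nat.card {b // T.hdeg b = n}

/-- An enumeration of the basis elements of homological degree `n`. -/
def enum (n : ℕ) : Fin (T.rank n) ≃ {b // T.hdeg b = n} :=
  haveI := T.finite_fiber n
  (Finite.equivFin _).symm

lemma fiberInc_fiberProj_D (n : ℕ) (x : Fin (T.rank (n + 1)) → MvPolynomial σ k) :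
    fiberInc (T.enum n) (fiberProj (T.enum n) (T.D (fiberInc (T.enum (n + 1)) x))) =
      T.D (fiberInc (T.enum (n + 1)) x) := by
  refine fiberInc_fiberProj _ fun c hc => ?_
  obtain ⟨b, hb, hbc⟩ := T.exists_of_D_ne_zero hc
  have := hdeg_eq_of_fiberInc_ne_zero _ hb
  omega

/-- A preimage under `D` may have parts in several homological degrees, but only its part of degree
`n + 1` contributes to degree `n`. -/
lemma exists_fiberProj_D_eq {n : ℕ} {x : Fin (T.rank n) → MvPolynomial σ k}
    (hD : T.D (fiberInc (T.enum n) x) = 0) (haug : T.aug (fiberInc (T.enum n) x) = 0) :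
    ∃ y, fiberProj (T.enum n) (T.D (fiberInc (T.enum (n + 1)) y)) = x := by
  obtain ⟨y, hy⟩ := T.exact _ hD haug
  refine ⟨fiberProj (T.enum (n + 1)) y, ?_⟩
  rw [← fiberProj_fiberInc (T.enum n) x, ← hy, ← sub_eq_zero, ← map_sub, ← map_sub]
  refine fiberProj_eq_zero _ fun c hc hcn => ?_
  obtain ⟨b, hb, hbc⟩ := T.exists_of_D_ne_zero hc
  refine hb ?_
  rw [Finsupp.sub_apply, fiberInc_fiberProj_apply _ _ (by omega), sub_self]

/-- The resolution given by a total resolution. -/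
def toResolution : MinimalGradedFreeResolution k σ ℳ where
  rank := T.rank
  deg n i := T.deg (T.enum n i)
  d n := fiberProj (T.enum n) ∘ₗ T.D ∘ₗ fiberInc (T.enum (n + 1))
  aug := T.aug ∘ₗ fiberInc (T.enum 0)
  aug_homogeneous i := by
    rw [LinearMap.comp_apply, fiberInc_single]
    exact T.aug_homogeneous _
  d_homogeneous n i c m h := by
    rw [LinearMap.comp_apply, LinearMap.comp_apply, fiberInc_single] at h
    exact T.D_homogeneous _ _ _ h
  aug_surjective m := by
    obtain ⟨y, rfl⟩ := T.aug_surjective m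
    refine ⟨fiberProj (T.enum 0) y, ?_⟩
    rw [LinearMap.comp_apply, ← sub_eq_zero, ← map_sub]
    refine T.aug_eq_zero fun b hb h0 => hb ?_
    rw [Finsupp.sub_apply, fiberInc_fiberProj_apply _ _ h0, sub_self]
  exact_aug x := by
    constructor
    · intro h
      refine T.exists_fiberProj_D_eq ?_ h
      ext1 c
      by_contra hc
      obtain ⟨b, hb, hbc⟩ := T.exists_of_D_ne_zero hc
      have := hdeg_eq_of_fiberInc_ne_zero _ hb
      omega
    · rintro ⟨y, rfl⟩
      simp only [LinearMap.comp_apply]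
      rw [T.fiberInc_fiberProj_D, T.aug_D]
  exact_d n x := by
    constructor
    · intro h
      refine T.exists_fiberProj_D_eq ?_ (T.aug_eq_zero fun b hb => ?_)
      · rw [← T.fiberInc_fiberProj_D]
        simp only [LinearMap.comp_apply] at h
        rw [h, map_zero]
      · rw [hdeg_eq_of_fiberInc_ne_zero _ hb]
        exact n.succ_ne_zero
    · rintro ⟨y, rfl⟩
      simp only [LinearMap.comp_apply]
      rw [T.fiberInc_fiberProj_D, T.D_D, map_zero]
  minimal n i c := by
    rw [LinearMap.comp_apply, LinearMap.comp_apply, fiberInc_single]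
    exact T.D_minimal _ _

lemma exists_enum_eq (b : T.B) : ∃ i, (T.enum (T.hdeg b) i : T.B) = b := by
  obtain ⟨i, hi⟩ := (T.enum (T.hdeg b)).surjective ⟨b, rfl⟩
  exact ⟨i, congrArg Subtype.val hi⟩

lemma iSup_toResolution {L : Type*} [CompleteLattice L] (f : ℕ → ℕ → L) :
    (⨆ b : Σ i, Fin (T.toResolution.rank i), f b.1 (T.toResolution.deg b.1 b.2)) =
      ⨆ b : T.B, f (T.hdeg b) (T.deg b) := by
  refine le_antisymm (iSup_le ?_) (iSup_le fun b => ?_)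
  · rintro ⟨n, i⟩
    refine le_iSup_of_le (T.enum n i : T.B) ?_
    rw [(T.enum n i).2]
    rfl
  · obtain ⟨i, hi⟩ := T.exists_enum_eq b
    refine le_iSup_of_le ⟨T.hdeg b, i⟩ ?_
    change f (T.hdeg b) (T.deg b) ≤ f (T.hdeg b) (T.deg (T.enum (T.hdeg b) i))
    rw [hi]

lemma regularity_eq (hℳ : IsGradedFamily (σ := σ) ℳ) :
    regularity k σ ℳ = ⨆ b : T.B,
      ((((T.deg b : ℤ) - (T.hdeg b : ℤ) : ℤ) : WithTop ℤ) : WithBot (WithTop ℤ)) := by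
  rw [T.toResolution.regularity_eq hℳ]
  exact T.iSup_toResolution fun i j => ((((j : ℤ) - (i : ℤ) : ℤ) : WithTop ℤ) : WithBot (WithTop ℤ))

lemma nonempty_B [Nontrivial M] : Nonempty T.B := by
  by_contra h
  rw [not_nonempty_iff] at h
  obtain ⟨x, hx⟩ := exists_ne (0 : M)
  obtain ⟨y, rfl⟩ := T.aug_surjective x
  exact hx (by rw [Subsingleton.elim y 0, map_zero])

end TotalResolution

lemma TotalResolution.projectiveDimension_eq.{v, w} {k : Type v} [Field k] {σ : Type w}
    {M : Type (max v w)} [AddCommGroup M] [Module k M] [Module (MvPolynomial σ k) M] [Nontrivial M]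
    {ℳ : ℕ → Submodule k M} (T : TotalResolution k σ ℳ) :
    CategoryTheory.projectiveDimension (ModuleCat.of (MvPolynomial σ k) M) =
      ⨆ b : T.B, ((T.hdeg b : ℕ∞) : WithBot ℕ∞) := by
  rw [T.toResolution.projectiveDimension_eq]
  exact T.iSup_toResolution fun i _ => ((i : ℕ∞) : WithBot ℕ∞)

namespace MinimalGradedFreeResolution

variable (F : MinimalGradedFreeResolution k σ ℳ)

/-- The basis elements of homological degree `n`. -/
def enum (n : ℕ) : Fin (F.rank n) ≃ {b : Σ i, Fin (F.rank i) // b.1 = n} where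
  toFun i := ⟨⟨n, i⟩, rfl⟩
  invFun b := Fin.cast (by rw [b.2]) b.1.2
  left_inv _ := rfl
  right_inv := by rintro ⟨⟨m, i⟩, rfl⟩; rfl

/-- The differential of a resolution on the sum of all its free modules. -/
def totalD : ((Σ i, Fin (F.rank i)) →₀ MvPolynomial σ k) →ₗ[MvPolynomial σ k]
    ((Σ i, Fin (F.rank i)) →₀ MvPolynomial σ k) :=
  Finsupp.linearCombination _ fun
    | ⟨0, _⟩ => 0
    | ⟨i + 1, b⟩ => fiberInc (F.enum i) (F.d i (Pi.single b 1))

/-- The augmentation of a resolution on the sum of all its free modules. -/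
def totalAug : ((Σ i, Fin (F.rank i)) →₀ MvPolynomial σ k) →ₗ[MvPolynomial σ k] M :=
  Finsupp.linearCombination _ fun
    | ⟨0, b⟩ => F.aug (Pi.single b 1)
    | ⟨_ + 1, _⟩ => 0

lemma totalD_fiberInc_zero (x) : F.totalD (fiberInc (F.enum 0) x) = 0 := by
  suffices h : F.totalD ∘ₗ fiberInc (F.enum 0) = 0 from LinearMap.congr_fun h x
  refine (Pi.basisFun _ _).ext fun b => ?_
  rw [Pi.basisFun_apply, LinearMap.comp_apply, fiberInc_single, totalD,
    Finsupp.linearCombination_single]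
  simp [enum]

lemma totalD_fiberInc_succ (i : ℕ) (x) : F.totalD (fiberInc (F.enum (i + 1)) x) =
    fiberInc (F.enum i) (F.d i x) := by
  suffices h : F.totalD ∘ₗ fiberInc (F.enum (i + 1)) = fiberInc (F.enum i) ∘ₗ F.d i from
    LinearMap.congr_fun h x
  refine (Pi.basisFun _ _).ext fun b => ?_
  rw [Pi.basisFun_apply, LinearMap.comp_apply, fiberInc_single, totalD,
    Finsupp.linearCombination_single]
  simp [enum]

lemma totalAug_fiberInc_zero (x) : F.totalAug (fiberInc (F.enum 0) x) = F.aug x := by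
  suffices h : F.totalAug ∘ₗ fiberInc (F.enum 0) = F.aug from LinearMap.congr_fun h x
  refine (Pi.basisFun _ _).ext fun b => ?_
  rw [Pi.basisFun_apply, LinearMap.comp_apply, fiberInc_single, totalAug,
    Finsupp.linearCombination_single]
  simp [enum]

lemma totalAug_fiberInc_succ (i : ℕ) (x) : F.totalAug (fiberInc (F.enum (i + 1)) x) = 0 := by
  suffices h : F.totalAug ∘ₗ fiberInc (F.enum (i + 1)) = 0 from LinearMap.congr_fun h x
  refine (Pi.basisFun _ _).ext fun b => ?_
  rw [Pi.basisFun_apply, LinearMap.comp_apply, fiberInc_single, totalAug,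
    Finsupp.linearCombination_single]
  simp [enum]

lemma sum_fiberInc_fiberProj (x : (Σ i, Fin (F.rank i)) →₀ MvPolynomial σ k) :
    ∃ N, ∀ n, N ≤ n →
      ∑ i ∈ Finset.range n, fiberInc (F.enum i) (fiberProj (F.enum i) x) = x := by
  classical
  refine ⟨x.support.sup Sigma.fst + 1, fun n hn => ?_⟩
  ext1 b
  rw [Finsupp.finsetSum_apply]
  by_cases hb : b.1 < n
  · rw [Finset.sum_eq_single b.1, fiberInc_fiberProj_apply _ _ rfl]
    · intro j _ hj
      exact fiberInc_apply_of_ne _ _ hj.symm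
    · intro h
      exact absurd (Finset.mem_range.2 hb) h
  · have hb0 : x b = 0 := by
      by_contra h
      have : b.1 ≤ x.support.sup Sigma.fst :=
        Finset.le_sup (f := Sigma.fst) (Finsupp.mem_support_iff.2 h)
      omega
    rw [hb0]
    refine Finset.sum_eq_zero fun j hj => fiberInc_apply_of_ne _ _ ?_
    have := Finset.mem_range.1 hj
    omega

lemma linearMap_ext_fiberInc {N : Type*} [AddCommGroup N] [Module (MvPolynomial σ k) N]
    {f g : ((Σ i, Fin (F.rank i)) →₀ MvPolynomial σ k) →ₗ[MvPolynomial σ k] N}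
    (h : ∀ i x, f (fiberInc (F.enum i) x) = g (fiberInc (F.enum i) x)) : f = g := by
  refine LinearMap.ext fun x => ?_
  obtain ⟨N, hN⟩ := F.sum_fiberInc_fiberProj x
  rw [← hN N le_rfl, map_sum, map_sum]
  exact Finset.sum_congr rfl fun i _ => h i _

lemma fiberProj_fiberInc_of_ne {i j : ℕ} (hij : i ≠ j) (x : Fin (F.rank j) → MvPolynomial σ k) :
    fiberProj (F.enum i) (fiberInc (F.enum j) x) = (0 : Fin (F.rank i) → MvPolynomial σ k) :=
  fiberProj_eq_zero _ fun _ hb h => hij (h.symm.trans (hdeg_eq_of_fiberInc_ne_zero _ hb))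

lemma fiberProj_totalD (i : ℕ) (x : (Σ i, Fin (F.rank i)) →₀ MvPolynomial σ k) :
    fiberProj (F.enum i) (F.totalD x) = F.d i (fiberProj (F.enum (i + 1)) x) := by
  suffices h : fiberProj (F.enum i) ∘ₗ F.totalD = F.d i ∘ₗ fiberProj (F.enum (i + 1)) from
    LinearMap.congr_fun h x
  refine F.linearMap_ext_fiberInc fun j y => ?_
  rw [LinearMap.comp_apply, LinearMap.comp_apply]
  cases j with
  | zero =>
    rw [totalD_fiberInc_zero, fiberProj_fiberInc_of_ne _ (by omega), map_zero, map_zero]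
  | succ j =>
    rw [totalD_fiberInc_succ]
    by_cases hij : i = j
    · subst hij
      rw [fiberProj_fiberInc, fiberProj_fiberInc]
    · rw [fiberProj_fiberInc_of_ne _ hij, fiberProj_fiberInc_of_ne _ (by omega), map_zero]

lemma totalAug_eq (x : (Σ i, Fin (F.rank i)) →₀ MvPolynomial σ k) :
    F.totalAug x = F.aug (fiberProj (F.enum 0) x) := by
  suffices h : F.totalAug = F.aug ∘ₗ fiberProj (F.enum 0) from LinearMap.congr_fun h x
  refine F.linearMap_ext_fiberInc fun j y => ?_
  rw [LinearMap.comp_apply]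
  cases j with
  | zero => rw [totalAug_fiberInc_zero, fiberProj_fiberInc]
  | succ j => rw [totalAug_fiberInc_succ, fiberProj_fiberInc_of_ne _ (by omega), map_zero]

/-- Exactness is solved in each homological degree separately; finite support of `x` means that
finitely many of the solutions have to be added. -/
lemma totalD_exact (x : (Σ i, Fin (F.rank i)) →₀ MvPolynomial σ k) (hx : F.totalD x = 0)
    (hx' : F.totalAug x = 0) : ∃ y, F.totalD y = x := by
  have h (i : ℕ) : ∃ y, F.d i y = fiberProj (F.enum i) x := by
    cases i with
    | zero => exact (F.exact_aug _).1 (by rw [← totalAug_eq, hx'])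
    | succ i => exact (F.exact_d i _).1 (by rw [← fiberProj_totalD, hx, map_zero])
  choose y hy using h
  obtain ⟨N, hN⟩ := F.sum_fiberInc_fiberProj x
  refine ⟨∑ i ∈ Finset.range N, fiberInc (F.enum (i + 1)) (y i), ?_⟩
  rw [map_sum, ← hN N le_rfl]
  refine Finset.sum_congr rfl fun i _ => ?_
  rw [totalD_fiberInc_succ, hy]

/-- The total resolution of a resolution. -/
def toTotal : TotalResolution k σ ℳ where
  B := Σ i, Fin (F.rank i)
  hdeg := Sigma.fst
  deg b := F.deg b.1 b.2
  finite_fiber n := Finite.of_equiv _ (F.enum n)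
  D := F.totalD
  aug := F.totalAug
  D_hdeg := by
    rintro ⟨_ | i, b⟩ c h
    · simp [totalD] at h
    · rw [totalD, Finsupp.linearCombination_single, one_smul] at h
      rw [hdeg_eq_of_fiberInc_ne_zero _ h]
  D_homogeneous := by
    rintro ⟨_ | i, b⟩ c m h
    · simp [totalD] at h
    · rw [totalD, Finsupp.linearCombination_single, one_smul] at h
      obtain ⟨j, c⟩ := c
      obtain rfl : j = i := hdeg_eq_of_fiberInc_ne_zero (F.enum i)
        (fun h0 => h (by rw [h0, coeff_zero]))
      have h2 := fiberInc_apply (F.enum j) (F.d j (Pi.single b 1)) c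
      exact F.d_homogeneous j b c m (by rw [← h2]; exact h)
  D_minimal := by
    rintro ⟨_ | i, b⟩ c
    · simp [totalD]
    · rw [totalD, Finsupp.linearCombination_single, one_smul]
      by_cases hc : c.1 = i
      · obtain ⟨j, c⟩ := c
        obtain rfl : j = i := hc
        have h2 := fiberInc_apply (F.enum j) (F.d j (Pi.single b 1)) c
        exact (congrArg constantCoeff h2).trans (F.minimal j b c)
      · rw [fiberInc_apply_of_ne _ _ hc, map_zero]
  aug_hdeg := by
    rintro ⟨_ | i, b⟩ h
    · exact absurd rfl h
    · simp [totalAug]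
  aug_homogeneous := by
    rintro ⟨_ | i, b⟩
    · rw [totalAug, Finsupp.linearCombination_single, one_smul]
      exact F.aug_homogeneous b
    · rw [totalAug, Finsupp.linearCombination_single, smul_zero]
      exact zero_mem _
  aug_surjective m := by
    obtain ⟨x, rfl⟩ := F.aug_surjective m
    exact ⟨_, F.totalAug_fiberInc_zero x⟩
  aug_D x := by
    rw [totalAug_eq, fiberProj_totalD]
    exact F.exact_aug.apply_apply_eq_zero _
  D_D x := by
    suffices h : F.totalD ∘ₗ F.totalD = 0 from LinearMap.congr_fun h x
    refine F.linearMap_ext_fiberInc fun j y => ?_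
    rw [LinearMap.comp_apply, LinearMap.zero_apply]
    rcases j with _ | _ | j
    · rw [totalD_fiberInc_zero, map_zero]
    · rw [totalD_fiberInc_succ, totalD_fiberInc_zero]
    · rw [totalD_fiberInc_succ, totalD_fiberInc_succ, (F.exact_d j).apply_apply_eq_zero, map_zero]
  exact := F.totalD_exact

end MinimalGradedFreeResolution

end

noncomputable section

/-! ### Contracting homotopies over the ground field. -/

section Homotopy

/-- An exact complex of vector spaces, with terms of even and odd degree, has a contracting
homotopy that exchanges the parities. -/
lemma exists_contracting_homotopy {k F M : Type*} [Field k] [AddCommGroup F] [AddCommGroup M]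
    [Module k F] [Module k M] {D p₀ p₁ q : F →ₗ[k] F} {aug : F →ₗ[k] M}
    (hp : ∀ x, p₀ x + p₁ x = x) (hp₀₁ : ∀ x, p₀ (p₁ x) = 0) (hp₁₀ : ∀ x, p₁ (p₀ x) = 0)
    (hD₀ : ∀ x, D (p₀ x) = p₁ (D x)) (hD₁ : ∀ x, D (p₁ x) = p₀ (D x))
    (hq : ∀ x, aug (q x) = aug x) (hDq : ∀ x, D (q x) = 0) (hp₁q : ∀ x, p₁ (q x) = 0)
    (haug₁ : ∀ x, aug (p₁ x) = 0) (haug : Function.Surjective aug) (haugD : ∀ x, aug (D x) = 0)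
    (hDD : ∀ x, D (D x) = 0) (hex : ∀ x, D x = 0 → aug x = 0 → ∃ y, D y = x) :
    ∃ (h : F →ₗ[k] F) (s : M →ₗ[k] F), (∀ m, aug (s m) = m) ∧ (∀ m, D (s m) = 0) ∧
      (∀ x, D (h x) + h (D x) = x - s (aug x)) ∧
      (∀ x, p₀ (h x) - p₁ (h x) = -h (p₀ x - p₁ x)) ∧ (∀ m, p₀ (s m) - p₁ (s m) = s m) := by
  obtain ⟨s₀, hs₀⟩ := aug.exists_rightInverse_of_surjective (LinearMap.range_eq_top.2 haug)
  obtain ⟨t, ht⟩ := D.rangeRestrict.exists_rightInverse_of_surjective D.range_rangeRestrict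
  obtain ⟨r, hr⟩ := LinearMap.exists_extend t
  set s : M →ₗ[k] F := q ∘ₗ s₀ with hs
  have hs1 (m) : aug (s m) = m := by
    rw [hs, LinearMap.comp_apply, hq]
    exact LinearMap.congr_fun hs₀ m
  have hs2 (m) : D (s m) = 0 := hDq _
  have hs3 (m) : p₁ (s m) = 0 := hp₁q _
  have hr1 (x) : D (r (D x)) = D x := by
    have h1 : r (D x) = t (D.rangeRestrict x) := LinearMap.congr_fun hr (D.rangeRestrict x)
    rw [h1]
    exact congrArg Subtype.val (LinearMap.congr_fun ht (D.rangeRestrict x))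
  -- `r` inverts `D` on its image. The correction makes its values lie in the kernel of `aug` and
  -- leaves `D ∘ r` unchanged, because `D ∘ s = 0`.
  set r' : F →ₗ[k] F := r - s ∘ₗ aug ∘ₗ r with hr'
  have hr2 (x) : D (r' (D x)) = D x := by
    simp [hr', hs2, hr1]
  have hr3 (x) : aug (r' x) = 0 := by
    simp [hr', hs1]
  -- `w` takes values in the common kernel of `D` and `aug`, which by exactness is the image of `D`;
  -- there `r'` supplies preimages, so `r' ∘ w` is a homotopy.
  set w : F →ₗ[k] F := LinearMap.id - s ∘ₗ aug - r' ∘ₗ D with hw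
  have hw1 (x) : D (r' (w x)) = w x := by
    obtain ⟨y, hy⟩ := hex (w x) (by simp [hw, hs2, hr2]) (by simp [hw, hs1, hr3])
    rw [← hy, hr2]
  set h : F →ₗ[k] F := r' ∘ₗ w with hh
  have hh1 (x) : D (h x) + h (D x) = x - s (aug x) := by
    rw [hh, LinearMap.comp_apply, hw1, LinearMap.comp_apply]
    simp [hw, haugD, hDD]
  have hp₀₀ (x) : p₀ (p₀ x) = p₀ x := by
    have := hp (p₀ x)
    rwa [hp₁₀, add_zero] at this
  have hp₁₁ (x) : p₁ (p₁ x) = p₁ x := by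
    have := hp (p₁ x)
    rwa [hp₀₁, zero_add] at this
  have haug₀ (x) : aug (p₀ x) = aug x := by
    conv_rhs => rw [← hp x, map_add, haug₁, add_zero]
  have hs4 (m) : p₀ (s m) = s m := by
    have := hp (s m)
    rwa [hs3, add_zero] at this
  -- Only the parity-reversing part of `h` is kept. It still satisfies the homotopy identity, since
  -- `D` reverses parity, and it anticommutes with the sign, as the tensor product requires.
  refine ⟨p₁ ∘ₗ h ∘ₗ p₀ + p₀ ∘ₗ h ∘ₗ p₁, s, hs1, hs2, fun x => ?_, fun x => ?_, fun m => ?_⟩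
  · have h0 := congrArg p₀ (hh1 (p₀ x))
    have h1 := congrArg p₁ (hh1 (p₁ x))
    simp only [map_add, map_sub, haug₀, haug₁, hp₀₀, hp₁₁, hs4, map_zero, sub_zero, hD₀, hD₁]
      at h0 h1
    simp only [LinearMap.add_apply, LinearMap.comp_apply, map_add, hD₀, hD₁]
    calc _ = (p₀ (D (h (p₀ x))) + p₀ (h (p₁ (D x)))) +
          (p₁ (D (h (p₁ x))) + p₁ (h (p₀ (D x)))) := by abel
      _ = p₀ x + p₁ x - s (aug x) := by rw [h0, h1]; abel
      _ = _ := by rw [hp]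
  · simp only [LinearMap.add_apply, LinearMap.comp_apply, map_add, map_sub, hp₀₀, hp₁₁, hp₀₁, hp₁₀,
      map_zero]
    abel
  · rw [hs3, hs4, sub_zero]

end Homotopy

namespace TotalResolution

variable {k : Type*} [Field k] {σ : Type*} {M : Type*} [AddCommGroup M] [Module k M]
  [Module (MvPolynomial σ k) M] {ℳ : ℕ → Submodule k M} (T : TotalResolution k σ ℳ)

/-- The sign involution `(-1)^hdeg`. -/
def sign : (T.B →₀ MvPolynomial σ k) →ₗ[k] (T.B →₀ MvPolynomial σ k) :=
  Finsupp.lsum ℕ fun b => (-1 : ℤ) ^ T.hdeg b • Finsupp.lsingle b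

lemma sign_apply (x : T.B →₀ MvPolynomial σ k) (b : T.B) :
    T.sign x b = (-1 : ℤ) ^ T.hdeg b • x b := by
  classical
  induction x using Finsupp.induction_linear with
  | zero => simp
  | add x y hx hy => rw [map_add, Finsupp.add_apply, hx, hy, Finsupp.add_apply, smul_add]
  | single c a =>
    rw [sign, Finsupp.lsum_single, LinearMap.smul_apply, Finsupp.smul_apply, Finsupp.lsingle_apply]
    by_cases h : c = b
    · rw [h]
    · rw [Finsupp.single_eq_of_ne (Ne.symm h), smul_zero, smul_zero]

lemma sign_single (b : T.B) (a : MvPolynomial σ k) :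
    T.sign (Finsupp.single b a) = (-1 : ℤ) ^ T.hdeg b • Finsupp.single b a := by
  rw [sign, Finsupp.lsum_single]
  rfl

/-- Restriction to the basis elements whose homological degree satisfies `P`. -/
def restrict (P : ℕ → Prop) : (T.B →₀ MvPolynomial σ k) →ₗ[k] (T.B →₀ MvPolynomial σ k) :=
  open Classical in
  (Submodule.subtype _) ∘ₗ Finsupp.restrictDom (MvPolynomial σ k) k {b | P (T.hdeg b)}

lemma restrict_apply (P : ℕ → Prop) [DecidablePred P] (x : T.B →₀ MvPolynomial σ k) (b : T.B) :
    T.restrict P x b = if P (T.hdeg b) then x b else 0 := by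
  simp [restrict, Finsupp.filter_apply]


lemma D_restrict {P Q : ℕ → Prop} (hPQ : ∀ n, P (n + 1) ↔ Q n) (x : T.B →₀ MvPolynomial σ k) :
    T.D (T.restrict P x) = T.restrict Q (T.D x) := by
  classical
  ext1 c
  rw [restrict_apply]
  split_ifs with h
  · rw [← sub_eq_zero, ← Finsupp.sub_apply, ← map_sub]
    by_contra hne
    obtain ⟨b, hb, hbc⟩ := T.exists_of_D_ne_zero hne
    rw [Finsupp.sub_apply, restrict_apply, if_pos (by rwa [← hbc, hPQ]), sub_self] at hb
    exact hb rfl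
  · by_contra hne
    obtain ⟨b, hb, hbc⟩ := T.exists_of_D_ne_zero hne
    rw [restrict_apply, if_neg (by rwa [← hbc, hPQ])] at hb
    exact hb rfl

lemma sign_eq (x : T.B →₀ MvPolynomial σ k) :
    T.sign x = T.restrict Even x - T.restrict (fun n => ¬ Even n) x := by
  classical
  ext1 b
  rw [sign_apply, Finsupp.sub_apply, restrict_apply, restrict_apply]
  by_cases h : Even (T.hdeg b)
  · simp [h]
  · simp [h, (Nat.not_even_iff_odd.1 h).neg_one_pow]

/-- `D` exchanges the even and the odd part. This is what makes the tensor differential square to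
zero. -/
lemma D_sign (x : T.B →₀ MvPolynomial σ k) : T.D (T.sign x) = - T.sign (T.D x) := by
  rw [sign_eq, sign_eq, map_sub, T.D_restrict (Q := fun n => ¬ Even n) fun n => Nat.even_add_one,
    T.D_restrict (Q := Even) fun n => by simp [Nat.even_add_one]]
  abel

variable [IsScalarTower k (MvPolynomial σ k) M]

lemma exists_homotopy : ∃ (h : (T.B →₀ MvPolynomial σ k) →ₗ[k] (T.B →₀ MvPolynomial σ k))
    (s : M →ₗ[k] (T.B →₀ MvPolynomial σ k)), (∀ m, T.aug (s m) = m) ∧ (∀ m, T.D (s m) = 0) ∧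
      (∀ x, T.D (h x) + h (T.D x) = x - s (T.aug x)) ∧
      (∀ x, T.sign (h x) = -h (T.sign x)) ∧ (∀ m, T.sign (s m) = s m) := by
  classical
  simp_rw [sign_eq]
  refine exists_contracting_homotopy (D := T.D.restrictScalars k) (aug := T.aug.restrictScalars k)
    -- Projecting to homological degree `0` does not change the augmentation, and it makes the
    -- section take values in even cycles.
    (q := T.restrict (· = 0))
    (fun x => ?_) (fun x => ?_) (fun x => ?_) (T.D_restrict fun n => ?_) (T.D_restrict fun n => ?_)
    (fun x => ?_) (fun x => ?_) (fun x => ?_) (fun x => ?_) T.aug_surjective T.aug_D T.D_D T.exact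
  · ext1 b
    rw [Finsupp.add_apply, restrict_apply, restrict_apply]
    by_cases h : Even (T.hdeg b) <;> simp [h]
  · ext1 b
    rw [restrict_apply, restrict_apply]
    by_cases h : Even (T.hdeg b) <;> simp [h]
  · ext1 b
    rw [restrict_apply, restrict_apply]
    by_cases h : Even (T.hdeg b) <;> simp [h]
  · simp [Nat.even_add_one]
  · simp [Nat.even_add_one]
  · rw [LinearMap.restrictScalars_apply, LinearMap.restrictScalars_apply, ← sub_eq_zero, ← map_sub]
    refine T.aug_eq_zero fun b hb h => hb ?_
    rw [Finsupp.sub_apply, restrict_apply, if_pos h, sub_self]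
  · have := T.D_restrict (P := (· = 0)) (Q := fun _ => False) (fun n => by simp) x
    rw [LinearMap.restrictScalars_apply, this]
    ext1 b
    simp [restrict_apply]
  · ext1 b
    rw [restrict_apply, restrict_apply]
    by_cases h : T.hdeg b = 0 <;> simp [h]
  · refine T.aug_eq_zero fun b hb h => hb ?_
    rw [restrict_apply, h]
    simp

end TotalResolution

end

noncomputable section

/-! ### Tensor products of resolutions. -/

section TensorPolynomial

variable (k : Type*) [Field k] {σ₁ σ₂ σ : Type*} {e₁ : σ₁ → σ} {e₂ : σ₂ → σ}

open scoped TensorProduct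

/-- `k[σ₁] ⊗ k[σ₂] ≃ k[σ]` if `σ` is the disjoint union of `σ₁` and `σ₂`. -/
def tensorRenameEquiv (he : Function.Bijective (Sum.elim e₁ e₂)) :
    MvPolynomial σ₁ k ⊗[k] MvPolynomial σ₂ k ≃ₐ[k] MvPolynomial σ k :=
  (tensorEquivSum k σ₁ σ₂ k).trans (renameEquiv k (Equiv.ofBijective _ he))

lemma tensorRenameEquiv_tmul (he : Function.Bijective (Sum.elim e₁ e₂)) (p : MvPolynomial σ₁ k)
    (q : MvPolynomial σ₂ k) :
    tensorRenameEquiv k he (p ⊗ₜ q) = rename e₁ p * rename e₂ q := by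
  suffices h : (tensorRenameEquiv k he : _ →ₐ[k] _) =
      Algebra.TensorProduct.productMap (rename e₁) (rename e₂) from
    (AlgHom.congr_fun h (p ⊗ₜ q)).trans (Algebra.TensorProduct.productMap_apply_tmul _ _ _ _)
  refine Algebra.TensorProduct.ext (MvPolynomial.algHom_ext fun i => ?_)
    (MvPolynomial.algHom_ext fun i => ?_)
  · simp [tensorRenameEquiv]
  · simp [tensorRenameEquiv]

/-- The tensor product of two free modules over polynomial rings in disjoint sets of variables. -/
def tensorFreeEquiv (he : Function.Bijective (Sum.elim e₁ e₂)) (B₁ B₂ : Type*) :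
    (B₁ →₀ MvPolynomial σ₁ k) ⊗[k] (B₂ →₀ MvPolynomial σ₂ k) ≃ₗ[k]
      (B₁ × B₂ →₀ MvPolynomial σ k) :=
  finsuppTensorFinsupp k k _ _ _ _ ≪≫ₗ
    Finsupp.mapRange.linearEquiv (tensorRenameEquiv k he).toLinearEquiv

variable {k}

@[simp] lemma tensorFreeEquiv_tmul_apply (he : Function.Bijective (Sum.elim e₁ e₂)) {B₁ B₂ : Type*}
    (x : B₁ →₀ MvPolynomial σ₁ k) (y : B₂ →₀ MvPolynomial σ₂ k) (b : B₁ × B₂) :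
    tensorFreeEquiv k he B₁ B₂ (x ⊗ₜ y) b = rename e₁ (x b.1) * rename e₂ (y b.2) := by
  rw [tensorFreeEquiv, LinearEquiv.trans_apply, Finsupp.mapRange.linearEquiv_apply]
  change tensorRenameEquiv k he _ = _
  rw [finsuppTensorFinsupp_apply, tensorRenameEquiv_tmul]

lemma tensorFreeEquiv_smul (he : Function.Bijective (Sum.elim e₁ e₂)) {B₁ B₂ : Type*}
    (p : MvPolynomial σ₁ k) (q : MvPolynomial σ₂ k)
    (x : B₁ →₀ MvPolynomial σ₁ k) (y : B₂ →₀ MvPolynomial σ₂ k) :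
    tensorFreeEquiv k he B₁ B₂ ((p • x) ⊗ₜ (q • y)) =
      (rename e₁ p * rename e₂ q) • tensorFreeEquiv k he B₁ B₂ (x ⊗ₜ y) := by
  ext1 b
  simp only [tensorFreeEquiv_tmul_apply, Finsupp.smul_apply, smul_eq_mul, map_mul]
  ring

lemma tensorFreeEquiv_neg_tmul (he : Function.Bijective (Sum.elim e₁ e₂)) {B₁ B₂ : Type*}
    (x : B₁ →₀ MvPolynomial σ₁ k) (y : B₂ →₀ MvPolynomial σ₂ k) :
    tensorFreeEquiv k he B₁ B₂ ((-x) ⊗ₜ y) = -tensorFreeEquiv k he B₁ B₂ (x ⊗ₜ y) := by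
  ext1 b
  simp

lemma tensorFreeEquiv_single (he : Function.Bijective (Sum.elim e₁ e₂)) {B₁ B₂ : Type*}
    (b₁ : B₁) (b₂ : B₂) (p : MvPolynomial σ₁ k) (q : MvPolynomial σ₂ k) :
    tensorFreeEquiv k he B₁ B₂ (Finsupp.single b₁ p ⊗ₜ Finsupp.single b₂ q) =
      Finsupp.single (b₁, b₂) (rename e₁ p * rename e₂ q) := by
  classical
  ext1 ⟨c₁, c₂⟩
  rw [tensorFreeEquiv_tmul_apply]
  by_cases h₁ : b₁ = c₁ <;> by_cases h₂ : b₂ = c₂ <;> simp [h₁, h₂]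

lemma isHomogeneousVec_tensorFreeEquiv (he : Function.Bijective (Sum.elim e₁ e₂)) {B₁ B₂ : Type*}
    {deg₁ : B₁ → ℕ} {deg₂ : B₂ → ℕ} {i j : ℕ}
    {x : B₁ →₀ MvPolynomial σ₁ k} {y : B₂ →₀ MvPolynomial σ₂ k}
    (hx : IsHomogeneousVec deg₁ i x) (hy : IsHomogeneousVec deg₂ j y) :
    IsHomogeneousVec (fun b : B₁ × B₂ => deg₁ b.1 + deg₂ b.2) (i + j)
      (tensorFreeEquiv k he B₁ B₂ (x ⊗ₜ y)) := by
  intro c m h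
  rw [tensorFreeEquiv_tmul_apply] at h
  obtain ⟨a, b, ha, hb, rfl⟩ := coeff_mul_ne_zero h
  obtain ⟨u, rfl, hu⟩ := coeff_rename_ne_zero _ _ _ ha
  obtain ⟨v, rfl, hv⟩ := coeff_rename_ne_zero _ _ _ hb
  have h1 := hx c.1 u hu
  have h2 := hy c.2 v hv
  rw [map_add, Finsupp.degree_mapDomain, Finsupp.degree_mapDomain]
  dsimp only
  omega

/-- The tensor product of two contracting homotopies. -/
lemma tensor_homotopy {F₁ F₂ : Type*} [AddCommGroup F₁] [AddCommGroup F₂] [Module k F₁]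
    [Module k F₂] {D₁ h₁ π₁ ε : F₁ →ₗ[k] F₁} {D₂ h₂ π₂ : F₂ →ₗ[k] F₂}
    (hh₁ : ∀ x, D₁ (h₁ x) + h₁ (D₁ x) = x - π₁ x) (hh₂ : ∀ x, D₂ (h₂ x) + h₂ (D₂ x) = x - π₂ x)
    (hεh : ∀ x, ε (h₁ x) = -h₁ (ε x)) (hεπ : ∀ x, ε (π₁ x) = π₁ x) (hπε : ∀ x, π₁ (ε x) = π₁ x)
    (hDπ : ∀ x, D₁ (π₁ x) = 0) (hπD : ∀ x, π₁ (D₁ x) = 0) {Δ H P : F₁ ⊗[k] F₂ →ₗ[k] F₁ ⊗[k] F₂}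
    (hΔ : ∀ x y, Δ (x ⊗ₜ y) = D₁ x ⊗ₜ y + ε x ⊗ₜ D₂ y)
    (hH : ∀ x y, H (x ⊗ₜ y) = h₁ x ⊗ₜ y + π₁ x ⊗ₜ h₂ y)
    (hP : ∀ x y, P (x ⊗ₜ y) = π₁ x ⊗ₜ π₂ y) (t : F₁ ⊗[k] F₂) :
    Δ (H t) + H (Δ t) + P t = t := by
  induction t using TensorProduct.induction_on with
  | zero => simp
  | add x y hx hy =>
    nth_rw 4 [← hx, ← hy]
    simp only [map_add]
    abel
  | tmul x y =>
    -- The computation is `1 - π₁ ⊗ π₂ = (1 - π₁) ⊗ 1 + π₁ ⊗ (1 - π₂)`; the cross terms `ε h₁ ⊗ D₂`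
    -- and `h₁ ε ⊗ D₂` cancel.
    have e₁ := eq_sub_of_add_eq (hh₁ x)
    have e₂ := eq_sub_of_add_eq (hh₂ y)
    simp only [hΔ, hH, hP, map_add, hDπ, hπD,
      hεπ, hπε, hεh, e₁, e₂, TensorProduct.sub_tmul, TensorProduct.tmul_sub,
      TensorProduct.neg_tmul, TensorProduct.zero_tmul]
    abel

/-- The tensor product of two complexes with contracting homotopies is exact. -/
lemma tensor_exact_of_homotopy {F₁ F₂ M₁ M₂ : Type*} [AddCommGroup F₁] [AddCommGroup F₂]
    [AddCommGroup M₁] [AddCommGroup M₂] [Module k F₁] [Module k F₂] [Module k M₁] [Module k M₂]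
    {D₁ h₁ ε : F₁ →ₗ[k] F₁} {D₂ h₂ : F₂ →ₗ[k] F₂} {A₁ : F₁ →ₗ[k] M₁} {A₂ : F₂ →ₗ[k] M₂}
    {s₁ : M₁ →ₗ[k] F₁} {s₂ : M₂ →ₗ[k] F₂}
    (hh₁ : ∀ x, D₁ (h₁ x) + h₁ (D₁ x) = x - s₁ (A₁ x))
    (hh₂ : ∀ x, D₂ (h₂ x) + h₂ (D₂ x) = x - s₂ (A₂ x))
    (hεh : ∀ x, ε (h₁ x) = -h₁ (ε x)) (hεs : ∀ x, ε (s₁ x) = s₁ x) (hAε : ∀ x, A₁ (ε x) = A₁ x)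
    (hDs : ∀ x, D₁ (s₁ x) = 0) (hAD : ∀ x, A₁ (D₁ x) = 0) {Δ : F₁ ⊗[k] F₂ →ₗ[k] F₁ ⊗[k] F₂}
    (hΔ : ∀ x y, Δ (x ⊗ₜ y) = D₁ x ⊗ₜ y + ε x ⊗ₜ D₂ y) {t : F₁ ⊗[k] F₂}
    (ht : Δ t = 0) (hA : TensorProduct.map A₁ A₂ t = 0) : ∃ w, Δ w = t := by
  have key := tensor_homotopy (π₁ := s₁ ∘ₗ A₁) (π₂ := s₂ ∘ₗ A₂) (Δ := Δ)
    (H := TensorProduct.map h₁ LinearMap.id + TensorProduct.map (s₁ ∘ₗ A₁) h₂)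
    (P := TensorProduct.map (s₁ ∘ₗ A₁) (s₂ ∘ₗ A₂)) hh₁ hh₂ hεh (fun x => hεs _)
    (fun x => congrArg s₁ (hAε x)) (fun x => hDs _)
    (fun x => (congrArg s₁ (hAD x)).trans (map_zero _)) hΔ (fun _ _ => rfl) (fun _ _ => rfl) t
  rw [ht, map_zero, add_zero, TensorProduct.map_comp, LinearMap.comp_apply, hA, map_zero,
    add_zero] at key
  exact ⟨_, key⟩

end TensorPolynomial

open scoped TensorProduct

variable {k : Type*} [Field k] {σ₁ σ₂ σ : Type*} {M₁ M₂ M : Type*}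
  [AddCommGroup M₁] [Module k M₁] [Module (MvPolynomial σ₁ k) M₁]
  [AddCommGroup M₂] [Module k M₂] [Module (MvPolynomial σ₂ k) M₂]
  [AddCommGroup M] [Module k M] [Module (MvPolynomial σ k) M]

/-- `M` is the tensor product over `k` of `M₁` and `M₂`, as a graded module over the polynomial ring
in the disjoint union of the variables. -/
structure IsExternalTensor (ℳ₁ : ℕ → Submodule k M₁) (ℳ₂ : ℕ → Submodule k M₂)
    (ℳ : ℕ → Submodule k M) (e₁ : σ₁ → σ) (e₂ : σ₂ → σ) (ν : M₁ →ₗ[k] M₂ →ₗ[k] M) : Prop where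
  bijective_elim : Function.Bijective (Sum.elim e₁ e₂)
  smul_smul : ∀ (p : MvPolynomial σ₁ k) (q : MvPolynomial σ₂ k) (x : M₁) (y : M₂),
    ν (p • x) (q • y) = (rename e₁ p * rename e₂ q) • ν x y
  bijective_lift : Function.Bijective (TensorProduct.lift ν)
  mem : ∀ {i j : ℕ} {x : M₁} {y : M₂}, x ∈ ℳ₁ i → y ∈ ℳ₂ j → ν x y ∈ ℳ (i + j)

namespace TotalResolution

variable {ℳ₁ : ℕ → Submodule k M₁} {ℳ₂ : ℕ → Submodule k M₂} {ℳ : ℕ → Submodule k M}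
  (T₁ : TotalResolution k σ₁ ℳ₁) (T₂ : TotalResolution k σ₂ ℳ₂)
  {e₁ : σ₁ → σ} {e₂ : σ₂ → σ} (he : Function.Bijective (Sum.elim e₁ e₂))
  (ν : M₁ →ₗ[k] M₂ →ₗ[k] M)

/-- The value of the differential of the tensor product at a pure tensor. -/
def tensorDAux (x : T₁.B →₀ MvPolynomial σ₁ k) (y : T₂.B →₀ MvPolynomial σ₂ k) :
    T₁.B × T₂.B →₀ MvPolynomial σ k :=
  tensorFreeEquiv k he T₁.B T₂.B (T₁.D x ⊗ₜ y + T₁.sign x ⊗ₜ T₂.D y)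

/-- The differential of the tensor product. -/
def tensorD : (T₁.B × T₂.B →₀ MvPolynomial σ k) →ₗ[MvPolynomial σ k]
    (T₁.B × T₂.B →₀ MvPolynomial σ k) :=
  Finsupp.linearCombination _ fun b =>
    T₁.tensorDAux T₂ he (Finsupp.single b.1 1) (Finsupp.single b.2 1)

/-- The augmentation of the tensor product. -/
def tensorAug : (T₁.B × T₂.B →₀ MvPolynomial σ k) →ₗ[MvPolynomial σ k] M :=
  Finsupp.linearCombination _ fun b =>
    ν (T₁.aug (Finsupp.single b.1 1)) (T₂.aug (Finsupp.single b.2 1))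

lemma sign_smul (p : MvPolynomial σ₁ k) (x : T₁.B →₀ MvPolynomial σ₁ k) :
    T₁.sign (p • x) = p • T₁.sign x := by
  ext1 b
  rw [sign_apply, Finsupp.smul_apply, Finsupp.smul_apply, sign_apply, smul_comm]

/-- The left side is `k[σ]`-linear by construction on a basis; the right side is the usual formula
on tensors over `k`. Their agreement lets exactness and `D² = 0` be checked on tensors. -/
lemma tensorD_tmul (x : T₁.B →₀ MvPolynomial σ₁ k) (y : T₂.B →₀ MvPolynomial σ₂ k) :
    T₁.tensorD T₂ he (tensorFreeEquiv k he T₁.B T₂.B (x ⊗ₜ y)) = T₁.tensorDAux T₂ he x y := by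
  induction x using Finsupp.induction_linear with
  | zero => simp [tensorDAux]
  | add x x' hx hx' =>
    rw [TensorProduct.add_tmul, map_add, map_add, hx, hx']
    simp only [tensorDAux, map_add, TensorProduct.add_tmul]
    abel
  | single b₁ p =>
    induction y using Finsupp.induction_linear with
    | zero => simp [tensorDAux]
    | add y y' hy hy' =>
      rw [TensorProduct.tmul_add, map_add, map_add, hy, hy']
      simp only [tensorDAux, map_add, TensorProduct.tmul_add]
      abel
    | single b₂ q =>
      rw [tensorFreeEquiv_single, tensorD, Finsupp.linearCombination_single]
      have hp : Finsupp.single b₁ p = p • Finsupp.single b₁ 1 := by simp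
      have hq : Finsupp.single b₂ q = q • Finsupp.single b₂ 1 := by simp
      rw [hp, hq]
      simp only [tensorDAux, map_smul, map_add, sign_smul, tensorFreeEquiv_smul, smul_add]

lemma tensorAug_tmul (hν : IsExternalTensor ℳ₁ ℳ₂ ℳ e₁ e₂ ν) (x : T₁.B →₀ MvPolynomial σ₁ k)
    (y : T₂.B →₀ MvPolynomial σ₂ k) :
    T₁.tensorAug T₂ ν (tensorFreeEquiv k he T₁.B T₂.B (x ⊗ₜ y)) = ν (T₁.aug x) (T₂.aug y) := by
  induction x using Finsupp.induction_linear with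
  | zero => simp
  | add x x' hx hx' =>
    rw [TensorProduct.add_tmul, map_add, map_add, hx, hx', map_add, map_add, LinearMap.add_apply]
  | single b₁ p =>
    induction y using Finsupp.induction_linear with
    | zero => simp
    | add y y' hy hy' =>
      rw [TensorProduct.tmul_add, map_add, map_add, hy, hy', map_add, map_add]
    | single b₂ q =>
      rw [tensorFreeEquiv_single, tensorAug, Finsupp.linearCombination_single]
      have hp : Finsupp.single b₁ p = p • Finsupp.single b₁ 1 := by simp
      have hq : Finsupp.single b₂ q = q • Finsupp.single b₂ 1 := by simp
      rw [hp, hq, T₁.aug.map_smul, T₂.aug.map_smul, hν.smul_smul]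

/-- Two additive maps on `B₁ × B₂ →₀ k[σ]` agree if they agree on pure tensors. -/
lemma tensorFree_induction {B₁ B₂ : Type*} {P : (B₁ × B₂ →₀ MvPolynomial σ k) → Prop}
    (hadd : ∀ x y, P x → P y → P (x + y)) (h0 : P 0)
    (h : ∀ x y, P (tensorFreeEquiv k he B₁ B₂ (x ⊗ₜ y))) (z) : P z := by
  obtain ⟨t, rfl⟩ := (tensorFreeEquiv k he B₁ B₂).surjective z
  induction t using TensorProduct.induction_on with
  | zero => rw [map_zero]; exact h0
  | tmul x y => exact h x y
  | add x y hx hy => rw [map_add]; exact hadd _ _ hx hy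

variable [IsScalarTower k (MvPolynomial σ₁ k) M₁] [IsScalarTower k (MvPolynomial σ₂ k) M₂]

/-- Exactness concerns only the underlying `k`-spaces, so `k`-linear homotopies of the factors
suffice. Injectivity of the lift of `ν` turns a vanishing augmentation into a vanishing tensor in
`M₁ ⊗ M₂`. -/
lemma tensor_exact (hν : IsExternalTensor ℳ₁ ℳ₂ ℳ e₁ e₂ ν)
    (z : T₁.B × T₂.B →₀ MvPolynomial σ k) (hz : T₁.tensorD T₂ he z = 0)
    (hz' : T₁.tensorAug T₂ ν z = 0) : ∃ w, T₁.tensorD T₂ he w = z := by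
  obtain ⟨h₁, s₁, has₁, hDs₁, hh₁, hsh₁, hss₁⟩ := T₁.exists_homotopy
  obtain ⟨h₂, s₂, has₂, hDs₂, hh₂, hsh₂, hss₂⟩ := T₂.exists_homotopy
  let E := tensorFreeEquiv k he T₁.B T₂.B
  let A₁ : _ →ₗ[k] M₁ := T₁.aug.restrictScalars k
  let A₂ : _ →ₗ[k] M₂ := T₂.aug.restrictScalars k
  let Δ := TensorProduct.map (T₁.D.restrictScalars k) LinearMap.id +
    TensorProduct.map T₁.sign (T₂.D.restrictScalars k)
  have hA (x) : T₁.aug (T₁.sign x) = T₁.aug x := by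
    rw [← sub_eq_zero, ← map_sub]
    refine T₁.aug_eq_zero fun b hb h0 => hb ?_
    rw [Finsupp.sub_apply, sign_apply, h0, pow_zero, one_smul, sub_self]
  have hΔ (t) : T₁.tensorD T₂ he (E t) = E (Δ t) := by
    induction t using TensorProduct.induction_on with
    | zero => simp only [map_zero]
    | add x y hx hy => simp only [map_add, hx, hy]
    | tmul x y => exact T₁.tensorD_tmul T₂ he x y
  obtain ⟨t, rfl⟩ := E.surjective z
  rw [hΔ] at hz
  replace hz : Δ t = 0 := E.injective (hz.trans (map_zero E).symm)
  have h0 : TensorProduct.map A₁ A₂ t = 0 := by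
    refine hν.bijective_lift.injective ?_
    rw [map_zero, ← hz']
    clear hz hz'
    induction t using TensorProduct.induction_on with
    | zero => simp only [map_zero]
    | add x y hx hy => simp only [map_add, hx, hy]
    | tmul x y => exact (T₁.tensorAug_tmul T₂ he ν hν x y).symm
  obtain ⟨w, hw⟩ := tensor_exact_of_homotopy (D₁ := T₁.D.restrictScalars k)
    (D₂ := T₂.D.restrictScalars k) (A₁ := A₁) (A₂ := A₂) hh₁ hh₂ hsh₁ hss₁ hA hDs₁ T₁.aug_D
    (fun _ _ => rfl) hz h0
  exact ⟨E w, (hΔ w).trans (congrArg E hw)⟩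

omit [IsScalarTower k (MvPolynomial σ₁ k) M₁] [IsScalarTower k (MvPolynomial σ₂ k) M₂] in
lemma tensorD_single (b : T₁.B × T₂.B) :
    T₁.tensorD T₂ he (Finsupp.single b 1) =
      tensorFreeEquiv k he T₁.B T₂.B (T₁.D (Finsupp.single b.1 1) ⊗ₜ Finsupp.single b.2 1) +
      (-1 : ℤ) ^ T₁.hdeg b.1 • tensorFreeEquiv k he T₁.B T₂.B
        (Finsupp.single b.1 1 ⊗ₜ T₂.D (Finsupp.single b.2 1)) := by
  rw [tensorD, Finsupp.linearCombination_single, one_smul, tensorDAux, map_add, sign_single]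
  congr 1
  rcases neg_one_pow_eq_or ℤ (T₁.hdeg b.1) with h | h <;>
    simp [h, tensorFreeEquiv_neg_tmul]

/-- The tensor product of two resolutions. -/
def tensor (hν : IsExternalTensor ℳ₁ ℳ₂ ℳ e₁ e₂ ν) : TotalResolution k σ ℳ where
  B := T₁.B × T₂.B
  hdeg b := T₁.hdeg b.1 + T₂.hdeg b.2
  deg b := T₁.deg b.1 + T₂.deg b.2
  finite_fiber n := by
    have h₁ (i : ℕ) : {b | T₁.hdeg b = i}.Finite := T₁.finite_fiber i
    have h₂ (i : ℕ) : {b | T₂.hdeg b = i}.Finite := T₂.finite_fiber i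
    refine Set.Finite.subset ((Finset.HasAntidiagonal.antidiagonal n).finite_toSet.biUnion
      fun p _ => (h₁ p.1).prod (h₂ p.2)) fun b hb => ?_
    exact Set.mem_biUnion (x := (T₁.hdeg b.1, T₂.hdeg b.2))
      (Finset.mem_coe.2 (Finset.HasAntidiagonal.mem_antidiagonal.2 hb)) ⟨rfl, rfl⟩
  D := T₁.tensorD T₂ hν.bijective_elim
  aug := T₁.tensorAug T₂ ν
  D_hdeg b c h := by
    classical
    rw [tensorD_single, Finsupp.add_apply, Finsupp.smul_apply, tensorFreeEquiv_tmul_apply,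
      tensorFreeEquiv_tmul_apply] at h
    by_cases h1 : T₁.D (Finsupp.single b.1 1) c.1 = 0
    · by_cases hb : b.1 = c.1
      · by_cases h2 : T₂.D (Finsupp.single b.2 1) c.2 = 0
        · simp [h1, h2] at h
        · have := T₂.D_hdeg _ _ h2
          rw [hb]
          omega
      · simp [h1, Finsupp.single_eq_of_ne (Ne.symm hb)] at h
    · by_cases hb : b.2 = c.2
      · have := T₁.D_hdeg _ _ h1
        rw [hb]
        omega
      -- Equality would contradict the drop of homological degree under `T₁.D`; otherwise both
      -- summands of the coefficient vanish.
      · by_cases hb1 : b.1 = c.1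
        · exfalso
          have h3 := T₁.D_hdeg _ _ h1
          rw [hb1] at h3
          omega
        · simp [Finsupp.single_eq_of_ne (Ne.symm hb), Finsupp.single_eq_of_ne (Ne.symm hb1)] at h
  D_homogeneous b := by
    classical
    rw [tensorD_single]
    refine Submodule.add_mem (vecGrading k σ _ _) ?_ ?_
    · refine isHomogeneousVec_tensorFreeEquiv _ (T₁.D_homogeneous b.1) ?_
      rw [Finsupp.single_eq_pi_single]
      exact isHomogeneousVec_single _ _
    · rw [Finsupp.coe_smul]
      refine zsmul_mem (S := Submodule k _) (K := vecGrading k σ _ _) ?_ _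
      refine isHomogeneousVec_tensorFreeEquiv _ ?_ (T₂.D_homogeneous b.2)
      rw [Finsupp.single_eq_pi_single]
      exact isHomogeneousVec_single _ _
  D_minimal b c := by
    rw [tensorD_single, Finsupp.add_apply, Finsupp.smul_apply, tensorFreeEquiv_tmul_apply,
      tensorFreeEquiv_tmul_apply, map_add, map_zsmul, map_mul, map_mul, constantCoeff_rename,
      constantCoeff_rename, constantCoeff_rename, constantCoeff_rename, T₁.D_minimal,
      T₂.D_minimal, zero_mul, mul_zero, smul_zero, add_zero]
  aug_hdeg b hb := by
    rw [tensorAug, Finsupp.linearCombination_single, one_smul]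
    by_cases h1 : T₁.hdeg b.1 = 0
    · rw [T₂.aug_hdeg b.2 (by omega), map_zero]
    · rw [T₁.aug_hdeg b.1 h1, map_zero, LinearMap.zero_apply]
  aug_homogeneous b := by
    rw [tensorAug, Finsupp.linearCombination_single, one_smul]
    exact hν.mem (T₁.aug_homogeneous _) (T₂.aug_homogeneous _)
  aug_surjective m := by
    obtain ⟨t, rfl⟩ := hν.bijective_lift.surjective m
    induction t using TensorProduct.induction_on with
    | zero => exact ⟨0, by simp⟩
    | tmul x y =>
      obtain ⟨x, rfl⟩ := T₁.aug_surjective x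
      obtain ⟨y, rfl⟩ := T₂.aug_surjective y
      exact ⟨_, T₁.tensorAug_tmul T₂ hν.bijective_elim ν hν x y⟩
    | add x y hx hy =>
      obtain ⟨x', hx'⟩ := hx
      obtain ⟨y', hy'⟩ := hy
      exact ⟨x' + y', by rw [map_add, map_add, hx', hy']⟩
  aug_D z := by
    refine tensorFree_induction hν.bijective_elim
      (P := fun z => T₁.tensorAug T₂ ν (T₁.tensorD T₂ hν.bijective_elim z) = 0) ?_ ?_ ?_ z
    · intro x y hx hy
      rw [map_add, map_add, hx, hy, add_zero]
    · simp
    · intro x y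
      rw [tensorD_tmul, tensorDAux, map_add, map_add, T₁.tensorAug_tmul T₂ _ ν hν,
        T₁.tensorAug_tmul T₂ _ ν hν, T₁.aug_D, T₂.aug_D]
      simp
  D_D z := by
    refine tensorFree_induction hν.bijective_elim (P := fun z => T₁.tensorD T₂ hν.bijective_elim
      (T₁.tensorD T₂ hν.bijective_elim z) = 0) ?_ ?_ ?_ z
    · intro x y hx hy
      rw [map_add, map_add, hx, hy, add_zero]
    · simp
    · intro x y
      rw [tensorD_tmul, tensorDAux, map_add, map_add, tensorD_tmul, tensorD_tmul, tensorDAux,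
        tensorDAux, T₁.D_D, T₂.D_D, D_sign]
      simp [tensorFreeEquiv_neg_tmul]
  exact := T₁.tensor_exact T₂ hν.bijective_elim ν hν

end TotalResolution

end

noncomputable section

/-! ### Suprema of sums over a product. -/

section Suprema

lemma exists_eq_iSup_of_bddAbove {L B : Type*} [CompleteLattice L] [Nonempty B] {f : B → ℤ}
    {φ : ℤ → L} (hφ : Monotone φ) (hf : BddAbove (Set.range f)) : ∃ b, φ (f b) = ⨆ b, φ (f b) := by
  obtain ⟨C, hC⟩ := hf
  obtain ⟨m, ⟨b, rfl⟩, hm⟩ := Int.exists_greatest_of_bdd (P := fun z => ∃ b, f b = z)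
    ⟨C, by rintro _ ⟨b, rfl⟩; exact hC ⟨b, rfl⟩⟩ ⟨_, Classical.arbitrary B, rfl⟩
  exact ⟨b, le_antisymm (le_iSup (fun b => φ (f b)) b) (iSup_le fun c => hφ (hm _ ⟨c, rfl⟩))⟩

/-- If the left side is a finite `C`, fixing one index bounds the other function, so both suprema
are attained and their sum is one of the terms. Nonemptiness excludes `⊥`. -/
lemma iSup_int_add_iSup_int {B₁ B₂ : Type*} [Nonempty B₁] [Nonempty B₂] (f : B₁ → ℤ) (g : B₂ → ℤ) :
    (⨆ p : B₁ × B₂, (((f p.1 + g p.2 : ℤ) : WithTop ℤ) : WithBot (WithTop ℤ))) =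
      (⨆ b, ((f b : WithTop ℤ) : WithBot (WithTop ℤ))) +
        ⨆ b, ((g b : WithTop ℤ) : WithBot (WithTop ℤ)) := by
  have hmono : Monotone fun z : ℤ => ((z : WithTop ℤ) : WithBot (WithTop ℤ)) := fun a b h =>
    WithBot.coe_le_coe.2 (WithTop.coe_le_coe.2 h)
  refine le_antisymm (iSup_le fun p => add_le_add
    (le_iSup (fun b => ((f b : WithTop ℤ) : WithBot (WithTop ℤ))) p.1)
    (le_iSup (fun b => ((g b : WithTop ℤ) : WithBot (WithTop ℤ))) p.2)) ?_
  have hle (b c) := le_iSup (fun p : B₁ × B₂ =>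
    (((f p.1 + g p.2 : ℤ) : WithTop ℤ) : WithBot (WithTop ℤ))) (b, c)
  generalize (⨆ p : B₁ × B₂,
    (((f p.1 + g p.2 : ℤ) : WithTop ℤ) : WithBot (WithTop ℤ))) = S at *
  induction S with
  | bot =>
    have := hle (Classical.arbitrary B₁) (Classical.arbitrary B₂)
    rw [le_bot_iff] at this
    exact absurd this WithBot.coe_ne_bot
  | coe S =>
    induction S with
    | top => exact le_top
    | coe C =>
      replace hle (b c) : f b + g c ≤ C :=
        WithTop.coe_le_coe.1 (WithBot.coe_le_coe.1 (hle b c))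
      obtain ⟨b, hb⟩ := exists_eq_iSup_of_bddAbove hmono (f := f)
        ⟨C - g (Classical.arbitrary B₂), by
          rintro _ ⟨b, rfl⟩
          exact le_sub_iff_add_le.2 (hle b _)⟩
      obtain ⟨c, hc⟩ := exists_eq_iSup_of_bddAbove hmono (f := g)
        ⟨C - f (Classical.arbitrary B₁), by
          rintro _ ⟨c, rfl⟩
          exact le_sub_iff_add_le'.2 (hle _ c)⟩
      rw [← hb, ← hc]
      exact hmono (hle b c)

lemma coe_iSup_natCast {B : Type*} [Nonempty B] (f : B → ℕ) :
    ((⨆ b, (f b : ℕ∞) : ℕ∞) : WithBot ℕ∞) = ⨆ b, ((f b : ℕ∞) : WithBot ℕ∞) :=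
  WithBot.coe_iSup (OrderTop.bddAbove _)

lemma iSup_nat_add_iSup_nat {B₁ B₂ : Type*} [Nonempty B₁] [Nonempty B₂] (f : B₁ → ℕ) (g : B₂ → ℕ) :
    (⨆ p : B₁ × B₂, (((f p.1 + g p.2 : ℕ) : ℕ∞) : WithBot ℕ∞)) =
      (⨆ b, ((f b : ℕ∞) : WithBot ℕ∞)) + ⨆ b, ((g b : ℕ∞) : WithBot ℕ∞) := by
  rw [← coe_iSup_natCast f, ← coe_iSup_natCast g,
    ← coe_iSup_natCast (fun p : B₁ × B₂ => f p.1 + g p.2), ← WithBot.coe_add]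
  refine congrArg _ (le_antisymm (iSup_le fun p => ?_) (ENat.iSup_add_iSup_le fun b c => ?_))
  · rw [Nat.cast_add]
    exact add_le_add (le_iSup (fun b => (f b : ℕ∞)) _) (le_iSup (fun b => (g b : ℕ∞)) _)
  · rw [← Nat.cast_add]
    exact le_iSup (fun p : B₁ × B₂ => ((f p.1 + g p.2 : ℕ) : ℕ∞)) (b, c)

end Suprema

end

noncomputable section

/-! ### Toric rings as graded modules. -/

section Toric

variable (k : Type*) [Field k] {V : Type*} (G : SimpleGraph V)

/-- The inclusion `k[G] ⊆ k[V]`. -/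
def toricVal : ToricRing k G →ₐ[k] MvPolynomial V k := (toricMap k G).range.val

lemma toricVal_injective : Function.Injective (toricVal k G) := Subtype.val_injective

lemma toricProj_surjective : Function.Surjective (toricProj k G) :=
  (toricMap k G).rangeRestrict_surjective

lemma toric_smul_def (p : MvPolynomial G.edgeSet k) (x : ToricRing k G) :
    p • x = toricProj k G p * x := rfl

instance : IsScalarTower k (MvPolynomial G.edgeSet k) (ToricRing k G) :=
  IsScalarTower.of_algebraMap_eq fun c => ((toricProj k G).commutes c).symm

instance : Nontrivial (ToricRing k G) :=
  ⟨0, 1, fun h => zero_ne_one (α := MvPolynomial V k) (by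
    rw [← map_zero (toricVal k G), ← map_one (toricVal k G), h])⟩

lemma toricProj_mem_toricGrading {p : MvPolynomial G.edgeSet k} {j : ℕ} (hp : p.IsHomogeneous j) :
    toricProj k G p ∈ toricGrading k G j := ⟨p, hp, rfl⟩

lemma isHomogeneous_toricMap {p : MvPolynomial G.edgeSet k} {j : ℕ} (hp : p.IsHomogeneous j) :
    (toricMap k G p).IsHomogeneous (2 * j) := by
  refine hp.aeval _ fun e => ?_
  obtain ⟨e, he⟩ := e
  induction e using Sym2.ind with
  | _ x y => exact (isHomogeneous_X k x).mul (isHomogeneous_X k y)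

/-- An edge goes to a product of two vertices, so degrees double. Hence the projections of the
grading of `k[G]` are induced by those of `k[V]` in even degrees. -/
lemma homogeneousComponent_toricMap (p : MvPolynomial G.edgeSet k) (j : ℕ) :
    homogeneousComponent (2 * j) (toricMap k G p) = toricMap k G (homogeneousComponent j p) := by
  conv_lhs => rw [← sum_homogeneousComponent p, map_sum, map_sum]
  rw [Finset.sum_congr rfl fun i _ => homogeneousComponent_of_mem
    (isHomogeneous_toricMap k G (homogeneousComponent_isHomogeneous i p))]
  by_cases hj : j < p.totalDegree + 1
  · rw [Finset.sum_eq_single j]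
    · simp
    · intro i _ hi
      rw [if_neg (by omega)]
    · intro h
      exact absurd (Finset.mem_range.2 hj) h
  · rw [homogeneousComponent_eq_zero _ _ (by omega), map_zero]
    refine Finset.sum_eq_zero fun i hi => if_neg ?_
    have := Finset.mem_range.1 hi
    omega

lemma isGradedFamily_toricGrading :
    IsGradedFamily (σ := G.edgeSet) (toricGrading k G) where
  smul_mem := by
    rintro i j p _ hp ⟨q, hq, rfl⟩
    rw [toric_smul_def]
    change toricProj k G p * toricProj k G q ∈ _
    rw [← map_mul]
    exact toricProj_mem_toricGrading k G (hp.mul hq)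
  exists_proj j := by
    have h (x : ToricRing k G) : ∃ y, toricVal k G y =
        homogeneousComponent (2 * j) (toricVal k G x) := by
      obtain ⟨p, rfl⟩ := toricProj_surjective k G x
      exact ⟨toricProj k G (homogeneousComponent j p),
        (homogeneousComponent_toricMap k G p j).symm⟩
    choose P hP using h
    refine ⟨{ toFun := P, map_add' := fun x y => ?_, map_smul' := fun c x => ?_ }, ?_⟩
    · refine toricVal_injective k G ?_
      rw [map_add, hP, hP, hP, map_add, map_add]
    · refine toricVal_injective k G ?_
      rw [map_smul, hP, hP, map_smul, map_smul, RingHom.id_apply]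
    · rintro i _ ⟨p, hp, rfl⟩
      refine toricVal_injective k G ((hP _).trans ?_)
      change homogeneousComponent (2 * j) (toricMap k G p) = _
      rw [homogeneousComponent_of_mem (isHomogeneous_toricMap k G hp)]
      by_cases hij : i = j
      · subst hij
        simp
        rfl
      · rw [if_neg (by omega), if_neg hij, map_zero]

/-- As a module over the edge ring, `k[G]` is cyclic, generated by `1` in degree `0`. -/
lemma nonempty_totalResolution [Finite G.edgeSet] :
    Nonempty (TotalResolution k G.edgeSet (toricGrading k G)) := by
  obtain ⟨F⟩ := (isGradedFamily_toricGrading k G).nonempty_resolution (n := 1) (fun _ => 0)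
    (fun _ => 1) (fun _ => by
      rw [← map_one (toricProj k G)]
      exact toricProj_mem_toricGrading k G (isHomogeneous_one _ _)) (by
      rw [eq_top_iff]
      intro x _
      obtain ⟨p, rfl⟩ := toricProj_surjective k G x
      rw [← mul_one (toricProj k G p), ← toric_smul_def]
      exact Submodule.smul_mem _ _ (Submodule.subset_span ⟨0, rfl⟩))
  exact ⟨F.toTotal⟩

variable {G} in
lemma toricReg_eq (T : TotalResolution k G.edgeSet (toricGrading k G)) :
    toricReg k G = ⨆ b : T.B,
      ((((T.deg b : ℤ) - (T.hdeg b : ℤ) : ℤ) : WithTop ℤ) : WithBot (WithTop ℤ)) :=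
  T.regularity_eq (isGradedFamily_toricGrading k G)

variable {G} in
lemma toricPd_eq (T : TotalResolution k G.edgeSet (toricGrading k G)) :
    toricPd k G = ⨆ b : T.B, ((T.hdeg b : ℕ∞) : WithBot ℕ∞) :=
  T.projectiveDimension_eq

/-- The resolution of the toric ring of a graph without edges. -/
def trivialResolution [IsEmpty G.edgeSet] :
    TotalResolution k G.edgeSet (toricGrading k G) where
  B := Unit
  hdeg _ := 0
  deg _ := 0
  finite_fiber _ := inferInstance
  D := 0
  aug := Finsupp.linearCombination _ fun _ => 1
  D_hdeg b c h := absurd rfl h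
  D_homogeneous b := isHomogeneousVec_zero _ _
  D_minimal b c := by simp
  aug_hdeg b h := absurd rfl h
  aug_homogeneous b := by
    rw [Finsupp.linearCombination_single, one_smul, ← map_one (toricProj k G)]
    exact toricProj_mem_toricGrading k G (isHomogeneous_one _ _)
  aug_surjective x := by
    obtain ⟨p, rfl⟩ := toricProj_surjective k G x
    refine ⟨Finsupp.single () p, ?_⟩
    rw [Finsupp.linearCombination_single, toric_smul_def, mul_one]
  aug_D x := by simp
  D_D x := by simp
  exact x _ hx := by
    refine ⟨0, ?_⟩
    have hx1 : x = Finsupp.single () (x ()) := Finsupp.unique_single x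
    rw [hx1, Finsupp.linearCombination_single, toric_smul_def, mul_one] at hx
    have h : toricMap k G (x ()) = 0 := (congrArg (toricVal k G) hx).trans (map_zero (toricVal k G))
    rw [eq_C_of_isEmpty (x ()), ← algebraMap_eq, AlgHom.commutes, algebraMap_eq, C_eq_zero] at h
    rw [LinearMap.zero_apply, hx1, eq_C_of_isEmpty (x ()), h, C_0, Finsupp.single_zero]

lemma toricReg_of_isEmpty [IsEmpty G.edgeSet] : toricReg k G = 0 := by
  rw [toricReg_eq k (trivialResolution k G)]
  have : Nonempty (trivialResolution k G).B := ⟨()⟩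
  exact ciSup_const (ι := (trivialResolution k G).B) (a := 0)

lemma toricPd_of_isEmpty [IsEmpty G.edgeSet] : toricPd k G = 0 := by
  rw [toricPd_eq k (trivialResolution k G)]
  have : Nonempty (trivialResolution k G).B := ⟨()⟩
  exact ciSup_const (ι := (trivialResolution k G).B) (a := 0)

end Toric

/-! ### The toric ring of a disjoint union. -/

section Union

variable (k : Type*) [Field k] {V₁ V₂ V : Type*} {G₁ : SimpleGraph V₁} {G₂ : SimpleGraph V₂}
  {G : SimpleGraph V}

lemma rename_toricMap (f : G₁ →g G) (p : MvPolynomial G₁.edgeSet k) :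
    rename f (toricMap k G₁ p) = toricMap k G (rename f.mapEdgeSet p) := by
  suffices h : (rename f).comp (toricMap k G₁) = (toricMap k G).comp (rename f.mapEdgeSet) from
    AlgHom.congr_fun h p
  refine MvPolynomial.algHom_ext fun e => ?_
  obtain ⟨e, he⟩ := e
  induction e using Sym2.ind with
  | _ x y => simp [toricMap, SimpleGraph.Hom.mapEdgeSet]

/-- The map of toric rings induced by a graph homomorphism. -/
def toricRingMap (f : G₁ →g G) : ToricRing k G₁ →ₐ[k] ToricRing k G :=
  ((rename f).comp (toricVal k G₁)).codRestrict (toricMap k G).range fun x => by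
    obtain ⟨p, rfl⟩ := toricProj_surjective k G₁ x
    exact ⟨rename f.mapEdgeSet p, (rename_toricMap k f p).symm⟩

lemma toricVal_toricRingMap (f : G₁ →g G) (x : ToricRing k G₁) :
    toricVal k G (toricRingMap k f x) = rename f (toricVal k G₁ x) := rfl

lemma toricRingMap_toricProj (f : G₁ →g G) (p : MvPolynomial G₁.edgeSet k) :
    toricRingMap k f (toricProj k G₁ p) = toricProj k G (rename f.mapEdgeSet p) :=
  toricVal_injective k G (rename_toricMap k f p)

open scoped TensorProduct

/-- `G` is the disjoint union of the images of two embeddings. -/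
structure IsDisjointUnion (f₁ : G₁ →g G) (f₂ : G₂ →g G) : Prop where
  injective : Function.Injective (Sum.elim f₁ f₂)
  adj : ∀ x y, G.Adj x y → (∃ a b, G₁.Adj a b ∧ f₁ a = x ∧ f₁ b = y) ∨
    (∃ a b, G₂.Adj a b ∧ f₂ a = x ∧ f₂ b = y)

variable {f₁ : G₁ →g G} {f₂ : G₂ →g G}

lemma IsDisjointUnion.bijective_elim (h : IsDisjointUnion f₁ f₂) :
    Function.Bijective (Sum.elim f₁.mapEdgeSet f₂.mapEdgeSet) := by
  have h₁ : Function.Injective f₁ := h.injective.comp Sum.inl_injective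
  have h₂ : Function.Injective f₂ := h.injective.comp Sum.inr_injective
  constructor
  · refine (SimpleGraph.Hom.mapEdgeSet.injective f₁ h₁).sumElim
      (SimpleGraph.Hom.mapEdgeSet.injective f₂ h₂) ?_
    rintro ⟨e, he⟩ ⟨e', he'⟩ heq
    replace heq : Sym2.map f₁ e = Sym2.map f₂ e' := congrArg Subtype.val heq
    induction e using Sym2.ind with
    | _ x y =>
      have : f₁ x ∈ Sym2.map f₂ e' := by
        rw [← heq]
        simp
      obtain ⟨z, -, hz⟩ := Sym2.mem_map.1 this
      exact Sum.inl_ne_inr (h.injective (a₁ := Sum.inl x) (a₂ := Sum.inr z) hz.symm)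
  · rintro ⟨e, he⟩
    induction e using Sym2.ind with
    | _ x y =>
      rcases h.adj x y he with ⟨a, b, hab, rfl, rfl⟩ | ⟨a, b, hab, rfl, rfl⟩
      · exact ⟨Sum.inl ⟨s(a, b), hab⟩, rfl⟩
      · exact ⟨Sum.inr ⟨s(a, b), hab⟩, rfl⟩

/-- The multiplication map `k[G₁] × k[G₂] → k[G]`. -/
def toricMul (f₁ : G₁ →g G) (f₂ : G₂ →g G) :
    ToricRing k G₁ →ₗ[k] ToricRing k G₂ →ₗ[k] ToricRing k G :=
  (LinearMap.mul k (ToricRing k G)).compl₁₂ (toricRingMap k f₁).toLinearMap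
    (toricRingMap k f₂).toLinearMap

lemma toricMul_apply (x : ToricRing k G₁) (y : ToricRing k G₂) :
    toricMul k f₁ f₂ x y = toricRingMap k f₁ x * toricRingMap k f₂ y := rfl

/-- Flatness over `k` embeds `k[G₁] ⊗ k[G₂]` into `k[V₁] ⊗ k[V₂]`, and the latter embeds into `k[V]`
because the two sets of vertices remain disjoint. -/
lemma IsDisjointUnion.injective_lift_toricMul (h : IsDisjointUnion f₁ f₂) :
    Function.Injective (TensorProduct.lift (toricMul k f₁ f₂)) := by
  let θ : MvPolynomial V₁ k ⊗[k] MvPolynomial V₂ k →ₐ[k] MvPolynomial V k :=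
    (rename (Sum.elim f₁ f₂)).comp (tensorEquivSum k V₁ V₂ k : _ →ₐ[k] _)
  have hθ : Function.Injective θ :=
    (rename_injective _ h.injective).comp (tensorEquivSum k V₁ V₂ k).injective
  have hθ' : θ = Algebra.TensorProduct.productMap (rename f₁) (rename f₂) := by
    refine Algebra.TensorProduct.ext (MvPolynomial.algHom_ext fun i => ?_)
      (MvPolynomial.algHom_ext fun i => ?_) <;> simp [θ]
  have hmap : Function.Injective
      (TensorProduct.map (toricVal k G₁).toLinearMap (toricVal k G₂).toLinearMap) :=
    TensorProduct.map_injective_of_flat_flat _ _ (toricVal_injective k G₁) (toricVal_injective k G₂)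
  have hcomp : (toricVal k G).toLinearMap ∘ₗ TensorProduct.lift (toricMul k f₁ f₂) =
      θ.toLinearMap ∘ₗ
        TensorProduct.map (toricVal k G₁).toLinearMap (toricVal k G₂).toLinearMap := by
    refine TensorProduct.ext' fun x y => ?_
    rw [hθ']
    simp [toricMul_apply, toricVal_toricRingMap]
  have := hθ.comp hmap
  refine Function.Injective.of_comp (f := toricVal k G) ?_
  exact (congrArg (fun f : _ →ₗ[k] _ => Function.Injective f) hcomp).mpr this

lemma IsDisjointUnion.surjective_lift_toricMul (h : IsDisjointUnion f₁ f₂) :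
    Function.Surjective (TensorProduct.lift (toricMul k f₁ f₂)) := by
  intro x
  obtain ⟨p, rfl⟩ := toricProj_surjective k G x
  obtain ⟨t, rfl⟩ := (tensorRenameEquiv k h.bijective_elim).surjective p
  induction t using TensorProduct.induction_on with
  | zero => exact ⟨0, by simp⟩
  | add x y hx hy =>
    obtain ⟨x', hx'⟩ := hx
    obtain ⟨y', hy'⟩ := hy
    exact ⟨x' + y', by rw [map_add, map_add, map_add, hx', hy']⟩
  | tmul p q =>
    refine ⟨toricProj k G₁ p ⊗ₜ toricProj k G₂ q, ?_⟩
    rw [TensorProduct.lift.tmul, toricMul_apply, toricRingMap_toricProj, toricRingMap_toricProj,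
      tensorRenameEquiv_tmul, map_mul]

lemma IsDisjointUnion.isExternalTensor (h : IsDisjointUnion f₁ f₂) :
    IsExternalTensor (toricGrading k G₁) (toricGrading k G₂) (toricGrading k G)
      f₁.mapEdgeSet f₂.mapEdgeSet (toricMul k f₁ f₂) where
  bijective_elim := h.bijective_elim
  smul_smul p q x y := by
    rw [toricMul_apply, toricMul_apply, toric_smul_def, toric_smul_def, toric_smul_def, map_mul,
      map_mul, map_mul, toricRingMap_toricProj, toricRingMap_toricProj]
    ring
  bijective_lift := ⟨h.injective_lift_toricMul k, h.surjective_lift_toricMul k⟩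
  mem := by
    rintro i j _ _ ⟨p, hp, rfl⟩ ⟨q, hq, rfl⟩
    rw [toricMul_apply]
    change toricRingMap k f₁ (toricProj k G₁ p) * toricRingMap k f₂ (toricProj k G₂ q) ∈ _
    rw [toricRingMap_toricProj, toricRingMap_toricProj, ← map_mul]
    exact toricProj_mem_toricGrading k G
      (IsHomogeneous.mul (IsHomogeneous.rename_isHomogeneous hp)
        (IsHomogeneous.rename_isHomogeneous hq))

/-- Both invariants are read off the tensor product of resolutions of the two factors, whose basis
is a product with additive degrees. -/
lemma IsDisjointUnion.toricReg_add_and_toricPd_add [Finite V₁] [Finite V₂]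
    (h : IsDisjointUnion f₁ f₂) :
    toricReg k G = toricReg k G₁ + toricReg k G₂ ∧ toricPd k G = toricPd k G₁ + toricPd k G₂ := by
  obtain ⟨T₁⟩ := nonempty_totalResolution k G₁
  obtain ⟨T₂⟩ := nonempty_totalResolution k G₂
  have := T₁.nonempty_B
  have := T₂.nonempty_B
  let T := T₁.tensor T₂ _ (h.isExternalTensor k)
  rw [toricReg_eq k T₁, toricReg_eq k T₂, toricReg_eq k T, toricPd_eq k T₁, toricPd_eq k T₂,
    toricPd_eq k T, ← iSup_int_add_iSup_int, ← iSup_nat_add_iSup_nat]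
  refine ⟨iSup_congr fun b => ?_, rfl⟩
  have : ((T.deg b : ℤ) - (T.hdeg b : ℤ)) =
      ((T₁.deg b.1 : ℤ) - T₁.hdeg b.1) + ((T₂.deg b.2 : ℤ) - T₂.hdeg b.2) := by
    change (((T₁.deg b.1 + T₂.deg b.2 : ℕ) : ℤ) - ((T₁.hdeg b.1 + T₂.hdeg b.2 : ℕ) : ℤ)) = _
    push_cast
    ring
  rw [this]

end Union

theorem mainTheorem6 {k : Type*} [Field k] {s : ℕ} {V : Fin s → Type*} [∀ i, Finite (V i)]
    (H : ∀ i, SimpleGraph (V i)) :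
    toricReg k (SimpleGraph.disjointUnion H) = ∑ i, toricReg k (H i) ∧
      toricPd k (SimpleGraph.disjointUnion H) = ∑ i, toricPd k (H i) := by
  induction s with
  | zero =>
    -- The empty union has no edges, so its toric ring is `k` over itself and both invariants equal
    -- the empty sum `0`.
    have : IsEmpty (SimpleGraph.disjointUnion H).edgeSet := by
      refine ⟨fun e => ?_⟩
      obtain ⟨e, he⟩ := e
      induction e using Sym2.ind with
      | _ x y => exact x.1.elim0
    exact ⟨toricReg_of_isEmpty k _, toricPd_of_isEmpty k _⟩
  | succ s ih =>
    -- The union is split into its member of index `0` and the union of the members of successor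
    -- index.
    let f₁ : H 0 →g SimpleGraph.disjointUnion H :=
      { toFun := fun a => ⟨0, a⟩
        map_rel' := fun {a b} hab => ⟨0, a, b, hab, rfl, rfl⟩ }
    let f₂ : SimpleGraph.disjointUnion (fun i : Fin s => H i.succ) →g SimpleGraph.disjointUnion H :=
      { toFun := fun a => ⟨a.1.succ, a.2⟩
        map_rel' := by
          rintro _ _ ⟨i, a, b, hab, rfl, rfl⟩
          exact ⟨i.succ, a, b, hab, rfl, rfl⟩ }
    have h : IsDisjointUnion f₁ f₂ := by
      constructor
      · refine Function.Injective.sumElim ?_ ?_ ?_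
        · intro a b hab
          exact eq_of_heq (Sigma.mk.inj hab).2
        · rintro ⟨i, a⟩ ⟨j, b⟩ hab
          obtain ⟨h1, h2⟩ := Sigma.mk.inj hab
          obtain rfl := Fin.succ_injective _ h1
          exact congrArg (Sigma.mk i) (eq_of_heq h2)
        · rintro a ⟨j, b⟩ hab
          exact (Fin.succ_ne_zero j) (Sigma.mk.inj hab).1.symm
      · rintro _ _ ⟨i, a, b, hab, rfl, rfl⟩
        cases i using Fin.cases with
        | zero => exact Or.inl ⟨a, b, hab, rfl, rfl⟩
        | succ i => exact Or.inr ⟨⟨i, a⟩, ⟨i, b⟩, ⟨i, a, b, hab, rfl, rfl⟩, rfl, rfl⟩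
    obtain ⟨hr, hp⟩ := h.toricReg_add_and_toricPd_add k
    obtain ⟨ihr, ihp⟩ := ih fun i => H i.succ
    rw [hr, hp, ihr, ihp, Fin.sum_univ_succ, Fin.sum_univ_succ]
    exact ⟨rfl, rfl⟩

end
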